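/- **Theorem (Effective dimension).** *Model.* Fix integers $q,r\ge 1$, a number $\sigma>0$ and a function $f:\mathbb{R}^q\times\mathbb{R}\to\mathbb{R}$. For each $n$ there are $n$ subjects; subject $i$ has $m_i\le M_{\rm obs}$ observations at known times $t_{i1},\dots,t_{im_i}$, with $M_{\rm obs}$ independent of $n$, a known covariate vector $V_i\in\mathbb{R}^p$ ($p=p_n>n$ for $n$ large) and a known matrix $Z_i\in\mathbb{R}^{m_i\times r}$ (all of these may vary with $n$). Let $X_i\in\mathbb{R}^{q\times qp}$ be the block diagonal matrix with $q$ diagonal blocks $V_i^\top$, let $X\in\mathbb{R}^{nq\times qp}$ be obtained by stacking $X_1,\dots,X_n$, let $\|X\|_*$ be the largest Euclidean norm of a column of $X$, and let $f_i(\varphi)=(f(\varphi,t_{i1}),\dots,f(\varphi,t_{im_i}))^\top$. The data $Y^{(n)}=(Y_1,\dots,Y_n)$ satisfy $$Y_i=f_i(X_i\beta)+Z_i\xi_i+\varepsilon_i,\qquad \xi_i\sim\mathcal N_r(0,\Gamma),\quad \varepsilon_i\sim\mathcal N_{m_i}(0,\sigma^2 I_{m_i}),$$ all $\xi_i,\varepsilon_i$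 being independent, with $\beta\in\mathbb{R}^{qp}$ and $\Gamma\in\mathbb{R}^{r\times r}$ symmetric positive definite unknown. Hence $Y_i\sim\mathcal N(f_i(X_i\beta),Z_i\Gamma Z_i^\top+\sigma^2I_{m_i})$. Write $S_\beta$ for the support of $\beta$, $\rho_{\min},\rho_{\max}$ for extreme eigenvalues and $\|A\|_{sp}=\rho_{\max}(A^\top A)^{1/2}$. *Prior.* $\beta$ and $\Gamma$ are independent. A size $s$ is drawn from a probability $\pi_p$ on $\{0,\dots,qp\}$, then $S$ uniformly among the subsets of size $s$ of the $qp$ coordinates; the coordinates $\beta_\ell$, $\ell\in S$, are i.i.d. with the Laplace density $\frac{\lambda}{2}e^{-\lambda|x|}$, $\lambda=\lambda_n>0$, and $\beta_\ell=0$ for $\ell\notin S$. $\Gamma$ has the inverse-Wishart density proportional to $|\Gamma|^{-(d+r+1)/2}\exp(-\frac12\mathrm{Tr}(\Sigma\Gamma^{-1}))$ with fixed $d>r-1$ and fixed positive definite $\Sigma$. $\Pi(\cdot\mid Y^{(n)})$ is the posterior. *Assumptions.* There are positive constants $K,A_1,\dots,A_4,L_1,L_2,L_3,b,\underline\rho,\overline\rho,\kappa,\underline{\rho_Z},\overline{\rho_Z}$,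 independent of $n$, and a sequence $\eta_n\to0$, such that (the conditions involving $n$ being required for $n$ large enough): 1. $|f(x,t)-f(y,t)|\le K\|x-y\|_2$ for all $x,y\in\mathbb{R}^q$, $t\in\mathbb{R}$; 2. $\mathcal B_0=\{\beta_0\ne0:\ \|\beta_0\|_\infty\le b\,\lambda^{-1}\log p,\ s_0\log p\le\eta_n n\}$, where $s_0=|S_{\beta_0}|$; 3. $\mathcal H_0=\{\Gamma_0 \text{ symmetric positive definite}:\ \underline\rho\le\rho_{\min}(\Gamma_0)\le\rho_{\max}(\Gamma_0)\le\overline\rho\}$; 4. $A_1p^{-A_3}\pi_p(s-1)\le\pi_p(s)\le A_2p^{-A_4}\pi_p(s-1)$ for $s=1,\dots,qp$; 5. $\dfrac{\|X\|_*K'}{L_1p^{L_2}}\le\lambda\le\dfrac{L_3\|X\|_*K'}{\sqrt n}$ with $K'=\sqrt{K^2M_{\rm obs}}$; 6. $\#\{i:m_i\ge r\}\ge\kappa n$; 7. $\rho_{\min}^{1/2}(Z_i^\top Z_i)\ge\underline{\rho_Z}$ for every $i$ with $m_i\ge r$; 8. $\max_i\|Z_i\|_{sp}\le\overline{\rho_Z}$.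 *Conclusion.* There is a constant $C_1>0$, depending only on $q,r,f,\sigma,d,\Sigma,M_{\rm obs}$ and the constants above (not on $n$, the design, the prior sequences or $\eta_n$), such that $$\sup_{\beta_0\in\mathcal B_0,\ \Gamma_0\in\mathcal H_0}\mathbb E_0\left[\Pi\left(\beta:\ |S_\beta|>C_1s_0\,\middle|\,Y^{(n)}\right)\right]\longrightarrow0\qquad(n\to\infty),$$ where $\mathbb E_0$ is the expectation when $Y^{(n)}$ follows the model with parameters $\beta_0,\Gamma_0$. -/

import Mathlib

open MeasureTheory ProbabilityTheory Filter Topology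
open scoped Matrix

namespace NLMM

noncomputable section

/-! ## The design and the model -/

/-- The known design for `n` subjects, `p` covariates, `q` individual parameters and `r` random
effects: subject `i` has `m i` observations, taken at the times `t i j`, the covariate vector
`V i` and the random effects design matrix `Z i`, whose `j`-th row is `Z_i(t_ij)`. -/
structure Design (n p q r : ℕ) where
  m : Fin n → ℕ
  t : (i : Fin n) → Fin (m i) → ℝ
  V : Fin n → Fin p → ℝ
  Z : (i : Fin n) → Matrix (Fin (m i)) (Fin r) ℝ

/-- The space `ℝ^{qp}` of regression parameters. The coordinate `(k, l)` of `β = Vec(β̃ᵀ)` is the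
entry `β̃_{kl}` of the `q × p` coefficient matrix. -/
abbrev Coef (p q : ℕ) : Type := Fin q × Fin p → ℝ

/-- The space of `r × r` real matrices. -/
abbrev Mat (r : ℕ) : Type := Matrix (Fin r) (Fin r) ℝ

instance instMeasurableSpaceMat (r : ℕ) : MeasurableSpace (Mat r) :=
  inferInstanceAs (MeasurableSpace (Fin r → Fin r → ℝ))

/-- `s_β`, the number of non-zero coordinates of `β`. -/
def suppCard {p q : ℕ} (β : Coef p q) : ℕ := (Finset.univ.filter fun l => β l ≠ 0).card

/-- The smallest eigenvalue (of a symmetric matrix). -/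
def rhoMin {r : ℕ} (A : Mat r) : ℝ := sInf (spectrum ℝ A)

/-- The largest eigenvalue (of a symmetric matrix). -/
def rhoMax {r : ℕ} (A : Mat r) : ℝ := sSup (spectrum ℝ A)

/-- The spectral norm `ρ_max(AᵀA)^{1/2}`. -/
def spNorm {m r : ℕ} (A : Matrix (Fin m) (Fin r) ℝ) : ℝ := √(rhoMax (A.transpose * A))

/-- `‖A‖_*`, the largest Euclidean norm of a column of `A`. -/
def starNorm {ι κ : Type*} [Fintype ι] (A : Matrix ι κ ℝ) : ℝ := ⨆ j, √(∑ i, A i j ^ 2)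

namespace Design

variable {n p q r : ℕ}

/-- The data space: subject `i` contributes a vector of `ℝ^{m_i}`. -/
abbrev Data (D : Design n p q r) : Type := (i : Fin n) → EuclideanSpace ℝ (Fin (D.m i))

/-- The block matrix `X_i`, with `V_iᵀ` on its diagonal. -/
def X (D : Design n p q r) (i : Fin n) : Matrix (Fin q) (Fin q × Fin p) ℝ :=
  Matrix.of fun k kl => if k = kl.1 then D.V i kl.2 else 0

/-- The matrix `X` obtained by stacking `X_1, …, X_n`. -/
def stackedX (D : Design n p q r) : Matrix (Fin n × Fin q) (Fin q × Fin p) ℝ :=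
  Matrix.of fun ik kl => D.X ik.1 ik.2 kl

/-- `f_i(X_i β) ∈ ℝ^{m_i}`. -/
def mean (D : Design n p q r) (f : EuclideanSpace ℝ (Fin q) → ℝ → ℝ) (β : Coef p q) (i : Fin n) :
    EuclideanSpace ℝ (Fin (D.m i)) :=
  WithLp.toLp 2 fun j => f (WithLp.toLp 2 (D.X i *ᵥ β)) (D.t i j)

/-- `Δ_{Γ,i} = Z_i Γ Z_iᵀ + σ² I`. -/
def Delta (D : Design n p q r) (σ : ℝ) (Γ : Mat r) (i : Fin n) : Mat (D.m i) :=
  D.Z i * Γ * (D.Z i).transpose + σ ^ 2 • (1 : Mat (D.m i))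

/-- The law of the data in the model `Y_i = f_i(X_i β) + Z_i ξ_i + ε_i`, with independent
`ξ_i ∼ N_r(0, Γ)` and `ε_i ∼ N_{m_i}(0, σ² I)`, independent over `i`. -/
def law (D : Design n p q r) (f : EuclideanSpace ℝ (Fin q) → ℝ → ℝ) (σ : ℝ)
    (β : Coef p q) (Γ : Mat r) : Measure D.Data :=
  Measure.pi fun i =>
    ((multivariateGaussian (0 : EuclideanSpace ℝ (Fin r)) Γ).prod
      (multivariateGaussian (0 : EuclideanSpace ℝ (Fin (D.m i)))
        (σ ^ 2 • (1 : Mat (D.m i))))).map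
      fun ξε => D.mean f β i + WithLp.toLp 2 (D.Z i *ᵥ ξε.1.ofLp) + ξε.2

end Design

/-- The Lebesgue density of the Gaussian law `N_m(μ, S)`, for a positive definite `S`. -/
def gaussianDensity {m : ℕ} (μ : EuclideanSpace ℝ (Fin m)) (S : Mat m)
    (y : EuclideanSpace ℝ (Fin m)) : ℝ :=
  (2 * Real.pi) ^ (-(m : ℝ) / 2) * S.det ^ (-(1 : ℝ) / 2) *
    Real.exp (-(1 / 2) * ((y - μ).ofLp ⬝ᵥ (S⁻¹ *ᵥ (y - μ).ofLp)))

/-- The likelihood `p_{β,Γ}(Y) = ∏ i, p_{β,Γ,i}(Y_i)`, where `p_{β,Γ,i}` is the density of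
`N(f_i(X_i β), Δ_{Γ,i})`. -/
def Design.likelihood {n p q r : ℕ} (D : Design n p q r) (f : EuclideanSpace ℝ (Fin q) → ℝ → ℝ)
    (σ : ℝ) (β : Coef p q) (Γ : Mat r) (Y : D.Data) : ℝ :=
  ∏ i, gaussianDensity (D.mean f β i) (D.Delta σ Γ i) (Y i)

/-! ## The prior -/

/-- The Laplace law on `ℝ`, with density `x ↦ (lam / 2) exp (-lam |x|)`. -/
def laplace (lam : ℝ) : Measure ℝ :=
  volume.withDensity fun x => ENNReal.ofReal (lam / 2 * Real.exp (-lam * |x|))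

/-- The spike-and-slab prior on `β`: the size `s` has law `π`, the support `S` is uniform among
the subsets of size `s`, the coordinates in `S` are independent Laplace variables and those
outside `S` are zero. -/
def priorBeta (p q : ℕ) (lam : ℝ) (π : ℕ → ℝ) : Measure (Coef p q) :=
  ∑ S : Finset (Fin q × Fin p), ENNReal.ofReal (π S.card / ((q * p).choose S.card : ℝ)) •
    Measure.pi fun l => if l ∈ S then laplace lam else Measure.dirac 0

/-- The symmetric matrix with prescribed entries on and above the diagonal. -/
def symmetricOf {r : ℕ} (x : {ij : Fin r × Fin r // ij.1 ≤ ij.2} → ℝ) : Mat r :=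
  Matrix.of fun i j =>
    if h : i ≤ j then x ⟨(i, j), h⟩ else x ⟨(j, i), (lt_of_not_ge h).le⟩

/-- Lebesgue measure on the symmetric `r × r` matrices, i.e. Lebesgue measure in the entries on
and above the diagonal. -/
def lebesgueSymm (r : ℕ) : Measure (Mat r) :=
  (volume : Measure ({ij : Fin r × Fin r // ij.1 ≤ ij.2} → ℝ)).map symmetricOf

/-- The inverse-Wishart density up to its normalizing constant. -/
def invWishartWeight {r : ℕ} (d : ℝ) (Sig Γ : Mat r) : ℝ :=
  Γ.det ^ (-(d + r + 1) / 2) * Real.exp (-(1 / 2) * (Sig * Γ⁻¹).trace)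

/-- The unnormalized inverse-Wishart measure, carried by the positive definite matrices. -/
def invWishartUnnormalized {r : ℕ} (d : ℝ) (Sig : Mat r) : Measure (Mat r) :=
  ((lebesgueSymm r).restrict {Γ | Γ.PosDef}).withDensity
    fun Γ => ENNReal.ofReal (invWishartWeight d Sig Γ)

/-- The inverse-Wishart prior on `Γ`, with `d` degrees of freedom and scale matrix `Sig`. -/
def invWishart {r : ℕ} (d : ℝ) (Sig : Mat r) : Measure (Mat r) :=
  (invWishartUnnormalized d Sig Set.univ)⁻¹ • invWishartUnnormalized d Sig

/-- The joint prior on `(β, Γ)`. -/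
def prior (p q : ℕ) {r : ℕ} (lam : ℝ) (π : ℕ → ℝ) (d : ℝ) (Sig : Mat r) :
    Measure (Coef p q × Mat r) :=
  (priorBeta p q lam π).prod (invWishart d Sig)

/-- The posterior law of `(β, Γ)` given the data `Y`, for the prior `Pr`, by Bayes' formula. -/
def Design.posterior {n p q r : ℕ} (D : Design n p q r)
    (f : EuclideanSpace ℝ (Fin q) → ℝ → ℝ) (σ : ℝ) (Pr : Measure (Coef p q × Mat r))
    (Y : D.Data) : Measure (Coef p q × Mat r) :=
  (∫⁻ θ, ENNReal.ofReal (D.likelihood f σ θ.1 θ.2 Y) ∂Pr)⁻¹ •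
    Pr.withDensity fun θ => ENNReal.ofReal (D.likelihood f σ θ.1 θ.2 Y)

/-! ## The classes of true parameters -/

/-- The non-zero `β₀` with `‖β₀‖_∞ ≤ b λ⁻¹ log p` and `s₀ log p ≤ η n`. The norm is the
supremum norm. -/
def trueBeta (n p q : ℕ) (lam b η : ℝ) : Set (Coef p q) :=
  {β | β ≠ 0 ∧ ‖β‖ ≤ b * (lam⁻¹ * Real.log p) ∧ suppCard β * Real.log p ≤ η * n}

/-- The symmetric positive definite matrices with all eigenvalues in `[lo, hi]`. -/
def trueGamma (r : ℕ) (lo hi : ℝ) : Set (Mat r) :=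
  {Γ | Γ.PosDef ∧ lo ≤ rhoMin Γ ∧ rhoMax Γ ≤ hi}

end

end NLMM

namespace NLMM

open scoped ENNReal

/-! ## Densities on finite products -/

/-! Write `A` for the set of models larger than `C₁ s₀`, `L` for the likelihood at a generic
parameter and `L₀` for the likelihood at the truth. The argument bypasses tests and high-probability
lower bounds on the evidence. For any set `B` of parameters on which `∫ L₀² / L` is at most `C`, and
any `ε > 0`, the elementary inequality `ψ L₀ ≤ ε L₀² / L + ε⁻¹ ψ L` for the posterior mass `ψ` of
`A`, averaged over `B` under the prior and integrated over the data, gives `E₀ Π(A | Y) ≤ ε C + ε⁻¹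
Π(A) / Π(B)` whenever `Π(B)` is positive and finite (`lintegral_posterior_le`). It remains to find
`B` with `C` bounded and `Π(A) / Π(B) = O(p⁻²)`, and to take `ε = 1 / p`.

The set `B` is a product. Put `E = ‖X‖_* K'`. The coefficients keep the true support and each moves
by at most `1 / (E s₀)`, so that the means of all subjects together move by at most 1 in Euclidean
norm. The covariance satisfies `Γ₀ ≤ Γ ≤ (1 + 1/n) Γ₀` in the Loewner order, so that each subject
contributes a factor of at most `(1 + 1/n)^(M/2)`. Both effects stay bounded in `n`
(`gaussianDensity_sq_le`, `lintegral_likelihood_sq_div_le`).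

The prior gives `B` mass at least of order `π(s₀) p^(-(b + L₂ + 3) s₀) p^(-N)`, where `N` is the
number of free entries of `Γ` (`priorBeta_supportBox_ge_rpow`,
`exists_invWishartUnnormalized_gammaBox_ge`). Geometric decay of the dimension prior gives `A` mass
at most of order `p · p^(-α (C₁ - 1) s₀) π(s₀)` with `α = A₄ / 2` (`prior_suppCard_le`). The factor
`π(s₀)` cancels, and a large constant `C₁` makes the ratio small, uniformly in the truth.

The inverse-Wishart measure must also be finite in order to be normalized; this is proved by
recursion on `r` through Schur complements (`lintegral_invWishartKernel_lt_top`). -/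

lemma lintegral_fin_prod {n : ℕ} {E : Fin n → Type*} [∀ i, MeasurableSpace (E i)]
    (μ : ∀ i, Measure (E i)) [∀ i, SigmaFinite (μ i)] {f : ∀ i, E i → ℝ≥0∞}
    (hf : ∀ i, Measurable (f i)) :
    ∫⁻ x, ∏ i, f i (x i) ∂Measure.pi μ = ∏ i, ∫⁻ x, f i x ∂μ i := by
  induction n with
  | zero => simp
  | succ n ih =>
    rw [← ((measurePreserving_piFinSuccAbove μ 0).symm).lintegral_comp_emb
      (MeasurableEquiv.measurableEmbedding _)]
    simp only [Fin.prod_univ_succ, MeasurableEquiv.piFinSuccAbove_symm_apply, Fin.insertNthEquiv,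
      Fin.insertNth_zero, Equiv.coe_fn_mk, Fin.cons_zero, Fin.cons_succ]
    rw [← ih (fun j => μ j.succ) (fun i => hf i.succ)]
    refine lintegral_prod_mul (ν := Measure.pi fun j : Fin n => μ j.succ)
      (g := fun x : (j : Fin n) → E j.succ => ∏ j, f j.succ (x j)) (hf 0).aemeasurable
      (Measurable.aemeasurable ?_)
    exact Finset.measurable_prod _ fun j _ => (hf j.succ).comp (measurable_pi_apply j)

lemma pi_withDensity {n : ℕ} {E : Fin n → Type*} [∀ i, MeasurableSpace (E i)]
    (μ : ∀ i, Measure (E i)) [∀ i, SigmaFinite (μ i)] {f : ∀ i, E i → ℝ≥0∞}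
    (hf : ∀ i, Measurable (f i)) [∀ i, SigmaFinite ((μ i).withDensity (f i))] :
    Measure.pi (fun i => (μ i).withDensity (f i)) =
      (Measure.pi μ).withDensity fun x => ∏ i, f i (x i) := by
  refine Measure.pi_eq fun s hs => ?_
  rw [withDensity_apply _ (MeasurableSet.univ_pi hs), Measure.restrict_pi_pi,
    lintegral_fin_prod _ hf]
  exact Finset.prod_congr rfl fun i _ => (withDensity_apply _ (hs i)).symm

/-! ## The density of the multivariate Gaussian law -/

lemma stdGaussian_eq_withDensity (m : ℕ) :
    stdGaussian (EuclideanSpace ℝ (Fin m)) = volume.withDensity fun x =>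
      ENNReal.ofReal ((2 * Real.pi) ^ (-(m : ℝ) / 2) * Real.exp (-(1 / 2) * (x.ofLp ⬝ᵥ x.ofLp))) := by
  rw [← map_pi_eq_stdGaussian, gaussianReal_of_var_ne_zero 0 one_ne_zero]
  have : SigmaFinite ((volume : Measure ℝ).withDensity (gaussianPDF 0 1)) := by
    rw [← gaussianReal_of_var_ne_zero 0 one_ne_zero]
    infer_instance
  rw [pi_withDensity (fun _ : Fin m => (volume : Measure ℝ)) (f := fun _ => gaussianPDF 0 1)
    (fun _ => measurable_gaussianPDF 0 1), ← volume_pi]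
  ext s hs
  rw [Measure.map_apply (by fun_prop) hs,
    withDensity_apply _ (measurableSet_preimage (by fun_prop) hs), withDensity_apply _ hs,
    ← (PiLp.volume_preserving_toLp (Fin m)).setLIntegral_comp_preimage hs
      (by fun_prop)]
  refine lintegral_congr fun x => ?_
  simp only [gaussianPDF]
  rw [← ENNReal.ofReal_prod_of_nonneg fun i _ => gaussianPDFReal_nonneg _ _ _]
  congr 1
  simp only [gaussianPDFReal, Finset.prod_mul_distrib, ← Real.exp_sum]
  congr 1
  · simp only [NNReal.coe_one, mul_one, Finset.prod_const, Finset.card_univ, Fintype.card_fin]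
    rw [Real.sqrt_eq_rpow, ← Real.rpow_neg (by positivity), ← Real.rpow_natCast,
      ← Real.rpow_mul (by positivity)]
    ring_nf
  · simp only [dotProduct, Finset.mul_sum]
    congr 1
    refine Finset.sum_congr rfl fun i _ => ?_
    simp
    ring

lemma measurable_gaussianDensity {m : ℕ} (μ : EuclideanSpace ℝ (Fin m)) (S : Mat m) :
    Measurable (gaussianDensity μ S) := by
  unfold gaussianDensity
  have : Continuous fun y : EuclideanSpace ℝ (Fin m) =>
      (y - μ).ofLp ⬝ᵥ (S⁻¹ *ᵥ (y - μ).ofLp) := by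
    refine Continuous.dotProduct (by fun_prop) (Continuous.matrix_mulVec (by fun_prop) (by fun_prop))
  exact (this.measurable.const_mul _).exp.const_mul _

lemma gaussianDensity_pos {m : ℕ} (μ : EuclideanSpace ℝ (Fin m)) {S : Mat m} (hS : S.PosDef)
    (y : EuclideanSpace ℝ (Fin m)) : 0 < gaussianDensity μ S y := by
  have := hS.det_pos
  unfold gaussianDensity
  positivity

-- Change of variables from the standard Gaussian by `x ↦ μ + √S x`: the Jacobian is `det √S = (det
-- S)^(1/2)`, and `S⁻¹` turns the quadratic form of `√S x` into `x ⬝ᵥ x`.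
open scoped MatrixOrder in
lemma multivariateGaussian_eq_withDensity {m : ℕ} (μ : EuclideanSpace ℝ (Fin m)) {S : Mat m}
    (hS : S.PosDef) :
    multivariateGaussian μ S = volume.withDensity fun y =>
      ENNReal.ofReal (gaussianDensity μ S y) := by
  set R : Mat m := CFC.sqrt S with hR
  have hRR : R * R = S := CFC.sqrt_mul_sqrt_self S hS.posSemidef.nonneg
  have hRt : R.transpose = R := by
    have := (Matrix.nonneg_iff_posSemidef.1 (CFC.sqrt_nonneg S)).isHermitian
    rwa [Matrix.IsHermitian, Matrix.conjTranspose_eq_transpose_of_trivial] at this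
  have hdet : R.det * R.det = S.det := by rw [← Matrix.det_mul, hRR]
  have hRdet : 0 < R.det := by
    have h1 : 0 ≤ R.det := (Matrix.nonneg_iff_posSemidef.1 (CFC.sqrt_nonneg S)).det_nonneg
    have h2 := hS.det_pos
    rcases h1.eq_or_lt with h | h
    · rw [← hdet, ← h] at h2; simp at h2
    · exact h
  have hRu : IsUnit R.det := hRdet.ne'.isUnit
  have hquad : ∀ x : Fin m → ℝ, (R *ᵥ x) ⬝ᵥ (S⁻¹ *ᵥ (R *ᵥ x)) = x ⬝ᵥ x := by
    intro x
    have : S⁻¹ * R = R⁻¹ := by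
      rw [← hRR, Matrix.mul_inv_rev, Matrix.mul_assoc, Matrix.nonsing_inv_mul _ hRu,
        Matrix.mul_one]
    rw [Matrix.mulVec_mulVec, this]
    have h2 : R *ᵥ x = x ᵥ* R := by rw [← Matrix.mulVec_transpose, hRt]
    rw [h2, ← Matrix.dotProduct_mulVec, Matrix.mulVec_mulVec,
      Matrix.mul_nonsing_inv _ hRu, Matrix.one_mulVec]
  set T : EuclideanSpace ℝ (Fin m) → EuclideanSpace ℝ (Fin m) :=
    fun x => μ + Matrix.toEuclideanCLM (𝕜 := ℝ) R x with hT
  have hTm : Measurable T := by fun_prop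
  have hdetL : LinearMap.det (Matrix.toEuclideanLin R) = R.det := by
    change LinearMap.det (Matrix.toLpLin 2 2 R) = _
    rw [Matrix.toLpLin_eq_toLin, LinearMap.det_toLin]
  have hvol : (volume : Measure (EuclideanSpace ℝ (Fin m))) =
      ENNReal.ofReal R.det • volume.map T := by
    have h1 : volume.map T = (volume.map (Matrix.toEuclideanLin R)).map (fun x => μ + x) := by
      rw [Measure.map_map (by fun_prop)
        (LinearMap.continuous_of_finiteDimensional _).measurable]
      rfl
    rw [h1, Measure.map_linearMap_addHaar_eq_smul_addHaar _ (by rw [hdetL]; exact hRdet.ne'),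
      hdetL, Measure.map_smul, map_add_left_eq_self, smul_smul, abs_of_pos (by positivity),
      ← ENNReal.ofReal_mul hRdet.le, mul_inv_cancel₀ hRdet.ne']
    simp
  rw [multivariateGaussian, ← hR, stdGaussian_eq_withDensity]
  ext s hs
  rw [Measure.map_apply hTm hs, withDensity_apply _ (hTm hs), withDensity_apply _ hs]
  conv_rhs => rw [hvol]
  rw [Measure.restrict_smul, lintegral_smul_measure, setLIntegral_map hs
    (measurable_gaussianDensity _ _).ennreal_ofReal hTm, smul_eq_mul,
    ← lintegral_const_mul _
      (f := fun x => ENNReal.ofReal (gaussianDensity μ S (T x)))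
      ((measurable_gaussianDensity _ _).ennreal_ofReal.comp hTm)]
  refine lintegral_congr fun x => ?_
  rw [← ENNReal.ofReal_mul hRdet.le]
  congr 1
  have hx : (T x - μ).ofLp = R *ᵥ x.ofLp := by
    simp [hT]
  rw [gaussianDensity, hx, hquad, ← hdet, Real.mul_rpow hRdet.le hRdet.le,
    ← Real.rpow_add hRdet]
  norm_num
  rw [Real.rpow_neg_one]
  field_simp

lemma lintegral_gaussianDensity {m : ℕ} (μ : EuclideanSpace ℝ (Fin m)) {S : Mat m}
    (hS : S.PosDef) : ∫⁻ y, ENNReal.ofReal (gaussianDensity μ S y) = 1 := by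
  have h := measure_univ (μ := multivariateGaussian μ S)
  rwa [multivariateGaussian_eq_withDensity μ hS, withDensity_apply _ MeasurableSet.univ,
    Measure.restrict_univ] at h

/-! ## The Loewner order and Gaussian densities -/

lemma PosDef.of_le {m : ℕ} {A B : Mat m} (hA : A.PosDef) (hAB : (B - A).PosSemidef) :
    B.PosDef := by
  simpa using hA.add_posSemidef hAB

lemma transpose_of_posDef {m : ℕ} {A : Mat m} (hA : A.PosDef) : A.transpose = A := by
  have := hA.isHermitian
  rwa [Matrix.IsHermitian, Matrix.conjTranspose_eq_transpose_of_trivial] at this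

lemma dotProduct_mulVec_comm {m : ℕ} {A : Mat m} (hA : A.transpose = A) (x y : Fin m → ℝ) :
    x ⬝ᵥ (A *ᵥ y) = y ⬝ᵥ (A *ᵥ x) := by
  rw [Matrix.dotProduct_mulVec, ← Matrix.mulVec_transpose, hA, dotProduct_comm]

/-- With `u = B⁻¹ y` and `v = A⁻¹ y`, add the inequalities `0 ≤ (u - v)ᵀ A (u - v)` and `0 ≤ uᵀ (B -
A) u`; the terms in `uᵀ A u` cancel. -/
lemma dotProduct_inv_mulVec_anti {m : ℕ} {A B : Mat m} (hA : A.PosDef)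
    (hAB : (B - A).PosSemidef) (y : Fin m → ℝ) : y ⬝ᵥ (B⁻¹ *ᵥ y) ≤ y ⬝ᵥ (A⁻¹ *ᵥ y) := by
  have hB := PosDef.of_le hA hAB
  have hAu : IsUnit A.det := hA.det_pos.ne'.isUnit
  have hBu : IsUnit B.det := hB.det_pos.ne'.isUnit
  set u := B⁻¹ *ᵥ y with hu
  set v := A⁻¹ *ᵥ y with hv
  have hAv : A *ᵥ v = y := by
    rw [hv, Matrix.mulVec_mulVec, Matrix.mul_nonsing_inv _ hAu, Matrix.one_mulVec]
  have hBu' : B *ᵥ u = y := by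
    rw [hu, Matrix.mulVec_mulVec, Matrix.mul_nonsing_inv _ hBu, Matrix.one_mulVec]
  have h1 : 0 ≤ (u - v) ⬝ᵥ (A *ᵥ (u - v)) := by
    simpa using hA.posSemidef.dotProduct_mulVec_nonneg (u - v)
  have h2 : 0 ≤ u ⬝ᵥ ((B - A) *ᵥ u) := by simpa using hAB.dotProduct_mulVec_nonneg u
  have h3 := dotProduct_mulVec_comm (transpose_of_posDef hA) v u
  rw [Matrix.sub_mulVec, dotProduct_sub, hBu'] at h2
  rw [Matrix.mulVec_sub, dotProduct_sub, sub_dotProduct, sub_dotProduct, h3, hAv] at h1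
  have h4 : v ⬝ᵥ y = y ⬝ᵥ v := dotProduct_comm _ _
  have h5 : u ⬝ᵥ y = y ⬝ᵥ u := dotProduct_comm _ _
  linarith

lemma dotProduct_inv_mulVec_le {m : ℕ} {A : Mat m} {τ : ℝ} (hτ : 0 < τ)
    (hA : (A - τ • (1 : Mat m)).PosSemidef) (y : Fin m → ℝ) :
    y ⬝ᵥ (A⁻¹ *ᵥ y) ≤ (y ⬝ᵥ y) / τ := by
  have h := dotProduct_inv_mulVec_anti (Matrix.PosDef.one.smul hτ) hA y
  have : (τ • (1 : Mat m))⁻¹ = τ⁻¹ • (1 : Mat m) :=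
    Matrix.inv_eq_left_inv (by simp [smul_smul, mul_inv_cancel₀ hτ.ne'])
  rwa [this, Matrix.smul_mulVec, Matrix.one_mulVec, dotProduct_smul, smul_eq_mul, mul_comm,
    ← div_eq_mul_inv] at h

/-- Up to a constant, `(det S)^(1/2)` is the integral of `exp(-½ yᵀ S⁻¹ y)`, and the integrand
increases with `S`. -/
lemma det_mono {m : ℕ} {A B : Mat m} (hA : A.PosDef) (hAB : (B - A).PosSemidef) :
    A.det ≤ B.det := by
  have hB := PosDef.of_le hA hAB
  have key : ∀ {S : Mat m}, S.PosDef →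
      ENNReal.ofReal (S.det ^ (1 / 2 : ℝ)) = ∫⁻ y : EuclideanSpace ℝ (Fin m),
        ENNReal.ofReal ((2 * Real.pi) ^ (-(m : ℝ) / 2) *
          Real.exp (-(1 / 2) * (y.ofLp ⬝ᵥ (S⁻¹ *ᵥ y.ofLp)))) := by
    intro S hS
    rw [← mul_one (ENNReal.ofReal (S.det ^ (1 / 2 : ℝ))), ← lintegral_gaussianDensity 0 hS,
      ← lintegral_const_mul _ (measurable_gaussianDensity _ _).ennreal_ofReal]
    refine lintegral_congr fun y => ?_
    have hd := hS.det_pos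
    rw [← ENNReal.ofReal_mul (by positivity), gaussianDensity]
    congr 1
    have : S.det ^ (1 / 2 : ℝ) * S.det ^ (-(1 : ℝ) / 2) = 1 := by
      rw [← Real.rpow_add hd]; norm_num
    simp only [sub_zero]
    linear_combination ((2 * Real.pi) ^ (-(m : ℝ) / 2) *
      Real.exp (-(1 / 2) * (y.ofLp ⬝ᵥ (S⁻¹ *ᵥ y.ofLp)))) * this
  have hd := hA.det_pos
  have hd' := hB.det_pos
  have h : ENNReal.ofReal (A.det ^ (1 / 2 : ℝ)) ≤ ENNReal.ofReal (B.det ^ (1 / 2 : ℝ)) := by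
    rw [key hA, key hB]
    refine lintegral_mono fun y => ENNReal.ofReal_le_ofReal ?_
    have := dotProduct_inv_mulVec_anti hA hAB y.ofLp
    exact mul_le_mul_of_nonneg_left (Real.exp_le_exp.2 (by linarith)) (by positivity)
  rw [ENNReal.ofReal_le_ofReal_iff (by positivity)] at h
  exact (Real.rpow_le_rpow_iff hd.le hd'.le (by norm_num)).1 h

/-- The pointwise form of a bound on the chi-square divergence of two Gaussian laws. -/
lemma gaussianDensity_sq_le {m : ℕ} (μ₀ μ : EuclideanSpace ℝ (Fin m)) {S₀ S : Mat m} {c τ : ℝ}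
    (hc : 0 < c) (hτ : 0 < τ) (hS₀ : S₀.PosDef) (hτS : (S₀ - τ • (1 : Mat m)).PosSemidef)
    (h : (S - S₀).PosSemidef) (h' : (c • S₀ - S).PosSemidef) (y : EuclideanSpace ℝ (Fin m)) :
    gaussianDensity μ₀ S₀ y ^ 2 ≤ c ^ ((m : ℝ) / 2) * Real.exp (‖μ - μ₀‖ ^ 2 / τ) *
      (gaussianDensity ((2 : ℝ) • μ₀ - μ) S₀ y * gaussianDensity μ S y) := by
  have hS := PosDef.of_le hS₀ h
  have hd := hS.det_pos
  have hd₀ := hS₀.det_pos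
  have hdet : S.det ≤ c ^ m * S₀.det := by
    have := det_mono hS h'
    rwa [Matrix.det_smul, Fintype.card_fin] at this
  set a : Fin m → ℝ := (y - μ₀).ofLp with ha
  set e : Fin m → ℝ := (μ - μ₀).ofLp with he
  have h1 : (y - μ).ofLp = a - e := by
    ext i; simp [ha, he]
  have h2 : (y - ((2 : ℝ) • μ₀ - μ)).ofLp = a + e := by
    ext i; simp [ha, he]; ring
  -- The parallelogram identity explains the reflected mean `2 μ₀ - μ`: it completes the square, so
  -- that the quotient of densities is dominated by another Gaussian density with total mass 1.
  have hpar : (a + e) ⬝ᵥ (S₀⁻¹ *ᵥ (a + e)) + (a - e) ⬝ᵥ (S₀⁻¹ *ᵥ (a - e)) =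
      2 * (a ⬝ᵥ (S₀⁻¹ *ᵥ a)) + 2 * (e ⬝ᵥ (S₀⁻¹ *ᵥ e)) := by
    simp only [Matrix.mulVec_add, Matrix.mulVec_sub, dotProduct_add, dotProduct_sub,
      add_dotProduct, sub_dotProduct]
    ring
  have hq := dotProduct_inv_mulVec_anti hS₀ h (a - e)
  have hqe : e ⬝ᵥ (S₀⁻¹ *ᵥ e) ≤ ‖μ - μ₀‖ ^ 2 / τ := by
    refine (dotProduct_inv_mulVec_le hτ hτS e).trans_eq ?_
    rw [EuclideanSpace.real_norm_sq_eq]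
    simp [dotProduct, he, sq]
  have hexp : Real.exp (-(1 / 2) * (a ⬝ᵥ (S₀⁻¹ *ᵥ a))) ^ 2 ≤ Real.exp (‖μ - μ₀‖ ^ 2 / τ) *
      (Real.exp (-(1 / 2) * ((a + e) ⬝ᵥ (S₀⁻¹ *ᵥ (a + e)))) *
        Real.exp (-(1 / 2) * ((a - e) ⬝ᵥ (S⁻¹ *ᵥ (a - e))))) := by
    rw [sq, ← Real.exp_add, ← Real.exp_add, ← Real.exp_add, Real.exp_le_exp]
    linarith
  have hpre : (S₀.det ^ (-(1 : ℝ) / 2)) ^ 2 ≤ c ^ ((m : ℝ) / 2) *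
      (S₀.det ^ (-(1 : ℝ) / 2) * S.det ^ (-(1 : ℝ) / 2)) := by
    have h3 : (c ^ m * S₀.det) ^ (-(1 : ℝ) / 2) ≤ S.det ^ (-(1 : ℝ) / 2) :=
      Real.rpow_le_rpow_of_nonpos hd hdet (by norm_num)
    have h4 : (c ^ m * S₀.det) ^ (-(1 : ℝ) / 2) =
        c ^ (-((m : ℝ) / 2)) * S₀.det ^ (-(1 : ℝ) / 2) := by
      rw [Real.mul_rpow (by positivity) hd₀.le, ← Real.rpow_natCast, ← Real.rpow_mul hc.le]
      congr 2
      ring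
    have h5 : c ^ ((m : ℝ) / 2) * c ^ (-((m : ℝ) / 2)) = 1 := by
      rw [← Real.rpow_add hc]; simp
    rw [h4] at h3
    calc (S₀.det ^ (-(1 : ℝ) / 2)) ^ 2
        = c ^ ((m : ℝ) / 2) * (S₀.det ^ (-(1 : ℝ) / 2) *
          (c ^ (-((m : ℝ) / 2)) * S₀.det ^ (-(1 : ℝ) / 2))) := by
          linear_combination -(S₀.det ^ (-(1 : ℝ) / 2)) ^ 2 * h5
      _ ≤ _ := by gcongr
  simp only [gaussianDensity, h1, h2]
  calc _ = ((2 * Real.pi) ^ (-(m : ℝ) / 2)) ^ 2 * ((S₀.det ^ (-(1 : ℝ) / 2)) ^ 2 *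
        Real.exp (-(1 / 2) * (a ⬝ᵥ (S₀⁻¹ *ᵥ a))) ^ 2) := by ring
    _ ≤ ((2 * Real.pi) ^ (-(m : ℝ) / 2)) ^ 2 * ((c ^ ((m : ℝ) / 2) *
      (S₀.det ^ (-(1 : ℝ) / 2) * S.det ^ (-(1 : ℝ) / 2))) * (Real.exp (‖μ - μ₀‖ ^ 2 / τ) *
      (Real.exp (-(1 / 2) * ((a + e) ⬝ᵥ (S₀⁻¹ *ᵥ (a + e)))) *
        Real.exp (-(1 / 2) * ((a - e) ⬝ᵥ (S⁻¹ *ᵥ (a - e))))))) := by gcongr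
    _ = _ := by ring

/-! ## Measurability of matrix-valued functions -/

instance instBorelSpaceMat (r : ℕ) : BorelSpace (Mat r) :=
  inferInstanceAs (BorelSpace (Fin r → Fin r → ℝ))

lemma measurable_det {Ω : Type*} [MeasurableSpace Ω] {m : ℕ} {A : Ω → Mat m}
    (hA : ∀ i j, Measurable fun ω => A ω i j) : Measurable fun ω => (A ω).det := by
  simp only [Matrix.det_apply]
  exact Finset.measurable_sum _ fun g _ =>
    (Finset.measurable_prod _ fun i _ => hA _ _).const_smul _

lemma measurable_inv_apply {Ω : Type*} [MeasurableSpace Ω] {m : ℕ} {A : Ω → Mat m}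
    (hA : ∀ i j, Measurable fun ω => A ω i j) (i j : Fin m) :
    Measurable fun ω => (A ω)⁻¹ i j := by
  simp only [Matrix.inv_def, Ring.inverse_eq_inv', Matrix.smul_apply, smul_eq_mul,
    Matrix.adjugate_apply]
  refine (measurable_det hA).inv.mul (measurable_det fun k l => ?_)
  by_cases h : k = j
  · subst h
    simp
  · simp only [Matrix.updateRow_ne h]
    exact hA k l

lemma measurable_gaussianDensity_comp {Ω : Type*} [MeasurableSpace Ω] {m : ℕ}
    {μ y : Ω → EuclideanSpace ℝ (Fin m)} {S : Ω → Mat m} (hμ : ∀ i, Measurable fun ω => μ ω i)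
    (hy : ∀ i, Measurable fun ω => y ω i) (hS : ∀ i j, Measurable fun ω => S ω i j) :
    Measurable fun ω => gaussianDensity (μ ω) (S ω) (y ω) := by
  have h1 : Measurable fun ω => (y ω - μ ω).ofLp ⬝ᵥ ((S ω)⁻¹ *ᵥ (y ω - μ ω).ofLp) := by
    simp only [dotProduct, Matrix.mulVec]
    refine Finset.measurable_sum _ fun i _ => Measurable.mul ?_ <|
      Finset.measurable_sum _ fun j _ => (measurable_inv_apply hS i j).mul ?_
    · exact (hy i).sub (hμ i)
    · exact (hy j).sub (hμ j)
  have h2 := measurable_det hS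
  unfold gaussianDensity
  exact ((h2.pow_const _).const_mul _).mul (h1.const_mul _).exp

lemma measurableSet_posDef (m : ℕ) : MeasurableSet {A : Mat m | A.PosDef} := by
  -- Semidefiniteness is an intersection of closed conditions, so the uncountable family of vectors
  -- is harmless; a nonzero determinant then replaces strict positivity.
  have h1 : {A : Mat m | A.PosDef} = {A | A.transpose = A} ∩
      (⋂ x : Fin m → ℝ, {A : Mat m | 0 ≤ x ⬝ᵥ (A *ᵥ x)}) ∩ {A | A.det ≠ 0} := by
    ext A
    simp only [Set.mem_ofPred_eq, Set.mem_inter_iff, Set.mem_iInter]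
    constructor
    · exact fun h => ⟨⟨transpose_of_posDef h, fun x => by
        simpa using h.posSemidef.dotProduct_mulVec_nonneg x⟩, h.det_pos.ne'⟩
    · rintro ⟨⟨h1, h2⟩, h3⟩
      have h4 : A.PosSemidef := Matrix.PosSemidef.of_dotProduct_mulVec_nonneg
        (by rwa [Matrix.IsHermitian, Matrix.conjTranspose_eq_transpose_of_trivial])
        (fun x => by simpa using h2 x)
      exact h4.posDef_iff_det_ne_zero.2 h3
  rw [h1]
  refine ((IsClosed.measurableSet ?_).inter (IsClosed.measurableSet ?_)).inter
    (IsOpen.measurableSet ?_)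
  · exact isClosed_eq continuous_id.matrix_transpose continuous_id
  · refine isClosed_iInter fun x => isClosed_le continuous_const ?_
    exact continuous_const.dotProduct (continuous_id.matrix_mulVec continuous_const)
  · exact isOpen_ne_fun continuous_id.matrix_det continuous_const

/-! ## The likelihood is the density of the law of the data -/

lemma Delta_sub_posSemidef {n p q r : ℕ} (D : Design n p q r) (σ : ℝ) {Γ : Mat r}
    (hΓ : Γ.PosSemidef) (i : Fin n) :
    (D.Delta σ Γ i - σ ^ 2 • (1 : Mat (D.m i))).PosSemidef := by
  have := hΓ.mul_mul_conjTranspose_same (D.Z i)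
  rw [Matrix.conjTranspose_eq_transpose_of_trivial] at this
  simpa [Design.Delta] using this

lemma Delta_posDef {n p q r : ℕ} (D : Design n p q r) {σ : ℝ} (hσ : 0 < σ) {Γ : Mat r}
    (hΓ : Γ.PosSemidef) (i : Fin n) : (D.Delta σ Γ i).PosDef :=
  PosDef.of_le (Matrix.PosDef.one.smul (by positivity)) (Delta_sub_posSemidef D σ hΓ i)

-- By characteristic functions: independence factors the exponential, and `⟪Z ξ, t⟫ = ⟪ξ, Zᵀ t⟫`
-- turns the covariance `Γ` into `Z Γ Zᵀ`.
open scoped RealInnerProductSpace in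
lemma map_prod_multivariateGaussian {m r : ℕ} (c : EuclideanSpace ℝ (Fin m))
    (Z : Matrix (Fin m) (Fin r) ℝ) {Γ : Mat r} (hΓ : Γ.PosSemidef) {S : Mat m}
    (hS : S.PosSemidef) :
    ((multivariateGaussian 0 Γ).prod (multivariateGaussian 0 S)).map
      (fun ξε => c + WithLp.toLp 2 (Z *ᵥ ξε.1.ofLp) + ξε.2) =
      multivariateGaussian c (Z * Γ * Z.transpose + S) := by
  have hg : Measurable fun ξε : EuclideanSpace ℝ (Fin r) × EuclideanSpace ℝ (Fin m) =>
      c + WithLp.toLp 2 (Z *ᵥ ξε.1.ofLp) + ξε.2 := by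
    have : Continuous fun ξε : EuclideanSpace ℝ (Fin r) × EuclideanSpace ℝ (Fin m) =>
        c + WithLp.toLp 2 (Z *ᵥ ξε.1.ofLp) + ξε.2 := by
      have : Continuous fun ξε : EuclideanSpace ℝ (Fin r) × EuclideanSpace ℝ (Fin m) =>
        Z *ᵥ ξε.1.ofLp := Continuous.matrix_mulVec (by fun_prop) (by fun_prop)
      fun_prop
    exact this.measurable
  have hΔ : (Z * Γ * Z.transpose + S).PosSemidef := by
    have := (hΓ.mul_mul_conjTranspose_same Z).add hS
    rwa [Matrix.conjTranspose_eq_transpose_of_trivial] at this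
  have := Measure.isProbabilityMeasure_map (μ := (multivariateGaussian 0 Γ).prod
    (multivariateGaussian 0 S)) hg.aemeasurable
  refine Measure.ext_of_charFun (funext fun t => ?_)
  rw [charFun_multivariateGaussian hΔ, charFun_apply, integral_map hg.aemeasurable (by fun_prop)]
  set u : EuclideanSpace ℝ (Fin r) := WithLp.toLp 2 (Z.transpose *ᵥ t.ofLp) with hu
  have hin : ∀ x : EuclideanSpace ℝ (Fin r), ⟪WithLp.toLp 2 (Z *ᵥ x.ofLp), t⟫ = ⟪x, u⟫ := by
    intro x
    simp only [EuclideanSpace.inner_eq_star_dotProduct, star_trivial, hu]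
    rw [Matrix.dotProduct_mulVec, Matrix.mulVec_transpose]
  have : ∀ x : EuclideanSpace ℝ (Fin r) × EuclideanSpace ℝ (Fin m),
      Complex.exp (⟪c + WithLp.toLp 2 (Z *ᵥ x.1.ofLp) + x.2, t⟫ * Complex.I) =
      Complex.exp (⟪c, t⟫ * Complex.I) * (Complex.exp (⟪x.1, u⟫ * Complex.I) *
        Complex.exp (⟪x.2, t⟫ * Complex.I)) := by
    intro x
    rw [← Complex.exp_add, ← Complex.exp_add, inner_add_left, inner_add_left, hin]
    push_cast
    ring_nf
  simp_rw [this]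
  rw [integral_const_mul, integral_prod_mul (fun x => Complex.exp (⟪x, u⟫ * Complex.I))
    (fun x => Complex.exp (⟪x, t⟫ * Complex.I)), ← charFun_apply, ← charFun_apply,
    charFun_multivariateGaussian hΓ, charFun_multivariateGaussian hS, ← Complex.exp_add,
    ← Complex.exp_add]
  congr 1
  have hquad : u.ofLp ⬝ᵥ (Γ *ᵥ u.ofLp) = t.ofLp ⬝ᵥ ((Z * Γ * Z.transpose) *ᵥ t.ofLp) := by
    rw [hu, ← Matrix.mulVec_mulVec, ← Matrix.mulVec_mulVec, Matrix.dotProduct_mulVec t.ofLp Z,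
      Matrix.mulVec_transpose]
  rw [hquad, Matrix.add_mulVec, dotProduct_add, real_inner_comm c t]
  simp
  ring

lemma law_eq_withDensity {n p q r : ℕ} (D : Design n p q r)
    (f : EuclideanSpace ℝ (Fin q) → ℝ → ℝ) {σ : ℝ} (hσ : 0 < σ) (β : Coef p q) {Γ : Mat r}
    (hΓ : Γ.PosSemidef) :
    D.law f σ β Γ = volume.withDensity fun Y => ENNReal.ofReal (D.likelihood f σ β Γ Y) := by
  have hS : ∀ i, ((multivariateGaussian (0 : EuclideanSpace ℝ (Fin r)) Γ).prod
      (multivariateGaussian (0 : EuclideanSpace ℝ (Fin (D.m i)))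
        (σ ^ 2 • (1 : Mat (D.m i))))).map
      (fun ξε => D.mean f β i + WithLp.toLp 2 (D.Z i *ᵥ ξε.1.ofLp) + ξε.2) =
      volume.withDensity
        fun y => ENNReal.ofReal (gaussianDensity (D.mean f β i) (D.Delta σ Γ i) y) := by
    intro i
    rw [map_prod_multivariateGaussian _ _ hΓ (Matrix.PosSemidef.one.smul (by positivity)),
      ← multivariateGaussian_eq_withDensity _ (Delta_posDef D hσ hΓ i)]
    rfl
  have : ∀ i, SigmaFinite ((volume : Measure (EuclideanSpace ℝ (Fin (D.m i)))).withDensity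
      fun y => ENNReal.ofReal (gaussianDensity (D.mean f β i) (D.Delta σ Γ i) y)) := by
    intro i
    rw [← multivariateGaussian_eq_withDensity _ (Delta_posDef D hσ hΓ i)]
    infer_instance
  rw [Design.law]
  simp_rw [hS]
  rw [pi_withDensity _ fun i => (measurable_gaussianDensity _ _).ennreal_ofReal, ← volume_pi]
  congr 1
  ext Y
  rw [Design.likelihood, ENNReal.ofReal_prod_of_nonneg fun i _ =>
    (gaussianDensity_pos _ (Delta_posDef D hσ hΓ i) _).le]

lemma lintegral_prod_gaussianDensity {n : ℕ} {m : Fin n → ℕ}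
    (μ : ∀ i, EuclideanSpace ℝ (Fin (m i))) {S : ∀ i, Mat (m i)} (hS : ∀ i, (S i).PosDef) :
    ∫⁻ Y : (i : Fin n) → EuclideanSpace ℝ (Fin (m i)),
      ENNReal.ofReal (∏ i, gaussianDensity (μ i) (S i) (Y i)) = 1 := by
  simp_rw [ENNReal.ofReal_prod_of_nonneg fun i _ => (gaussianDensity_pos (μ i) (hS i) _).le]
  rw [volume_pi, lintegral_fin_prod _ fun i => (measurable_gaussianDensity _ _).ennreal_ofReal]
  simp [lintegral_gaussianDensity _ (hS _)]

lemma measurable_likelihood {n p q r : ℕ} (D : Design n p q r)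
    {f : EuclideanSpace ℝ (Fin q) → ℝ → ℝ} (hf : ∀ t, Continuous fun x => f x t) (σ : ℝ) :
    Measurable fun z : (Coef p q × Mat r) × D.Data => D.likelihood f σ z.1.1 z.1.2 z.2 := by
  unfold Design.likelihood
  refine Finset.measurable_prod _ fun i _ => measurable_gaussianDensity_comp ?_ ?_ ?_
  · intro j
    have : Continuous fun β : Coef p q => f (WithLp.toLp 2 (D.X i *ᵥ β)) (D.t i j) := by
      refine (hf _).comp ((PiLp.continuous_toLp 2 _).comp ?_)
      exact continuous_const.matrix_mulVec continuous_id
    exact this.measurable.comp (by fun_prop)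
  · intro j
    fun_prop
  · intro j k
    have : Continuous fun Γ : Mat r => D.Delta σ Γ i j k := by
      unfold Design.Delta
      refine Continuous.matrix_elem ?_ j k
      exact ((continuous_const.matrix_mul continuous_id).matrix_mul continuous_const).add
        continuous_const
    exact this.measurable.comp (by fun_prop)

/-! ## A bound on the expected posterior mass -/

/-- If the likelihoods of the parameters in `B` have bounded chi-square divergence from the truth,
the expected posterior mass of `A` is controlled by the ratio of the prior masses. -/
lemma lintegral_posterior_le {Θ 𝒴 : Type*} [MeasurableSpace Θ] [MeasurableSpace 𝒴]
    (Pr : Measure Θ) [SFinite Pr] (ν : Measure 𝒴) [SFinite ν] {L : Θ × 𝒴 → ℝ≥0∞}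
    (hL : Measurable L) {L₀ : 𝒴 → ℝ≥0∞} (hL₀ : Measurable L₀)
    (hL₀top : ∀ y, L₀ y ≠ ∞)
    (hL1 : ∀ᵐ θ ∂Pr, ∫⁻ y, L (θ, y) ∂ν ≤ 1) {A B : Set Θ} (hB : MeasurableSet B)
    {C : ℝ≥0∞} (hC : ∀ θ ∈ B, ∫⁻ y, L₀ y ^ 2 / L (θ, y) ∂ν ≤ C) {ε : ℝ≥0∞} (hε : ε ≠ 0)
    (hε' : ε ≠ ∞) :
    Pr B * ∫⁻ y, (∫⁻ θ, L (θ, y) ∂Pr)⁻¹ * (∫⁻ θ in A, L (θ, y) ∂Pr) * L₀ y ∂ν ≤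
      ε * (C * Pr B) + ε⁻¹ * Pr A := by
  set ψ : 𝒴 → ℝ≥0∞ := fun y => (∫⁻ θ, L (θ, y) ∂Pr)⁻¹ * (∫⁻ θ in A, L (θ, y) ∂Pr) with hψ
  -- No positivity or finiteness of the evidence is needed: the conventions for the inverse in
  -- `ℝ≥0∞` make the product at most 1 in every case.
  have hψ1 : ∀ y, ψ y ≤ 1 := fun y =>
    (mul_le_mul_right (setLIntegral_le_lintegral _ _) _).trans (ENNReal.inv_mul_le_one _)
  have hψ2 : ∀ y, ψ y * ∫⁻ θ in B, L (θ, y) ∂Pr ≤ ∫⁻ θ in A, L (θ, y) ∂Pr := by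
    intro y
    calc ψ y * ∫⁻ θ in B, L (θ, y) ∂Pr ≤ ψ y * ∫⁻ θ, L (θ, y) ∂Pr :=
          mul_le_mul_right (setLIntegral_le_lintegral _ _) _
      _ = ((∫⁻ θ, L (θ, y) ∂Pr)⁻¹ * ∫⁻ θ, L (θ, y) ∂Pr) * (∫⁻ θ in A, L (θ, y) ∂Pr) := by
          rw [hψ]; ring
      _ ≤ 1 * _ := by gcongr; exact ENNReal.inv_mul_le_one _
      _ = _ := one_mul _
  -- Either `L₀ ≤ ε⁻¹ L`, and the second term suffices, or `L ≤ ε L₀`, and then `L₀ ≤ ε L₀² / L`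
  -- together with `ψ ≤ 1` gives the first.
  have hpt : ∀ θ y, ψ y * L₀ y ≤ ε * (L₀ y ^ 2 / L (θ, y)) + ε⁻¹ * (ψ y * L (θ, y)) := by
    intro θ y
    rcases le_total (L₀ y) (ε⁻¹ * L (θ, y)) with h | h
    · calc ψ y * L₀ y ≤ ψ y * (ε⁻¹ * L (θ, y)) := by gcongr
        _ = ε⁻¹ * (ψ y * L (θ, y)) := by ring
        _ ≤ _ := le_add_self
    · refine le_trans ?_ (le_self_add)
      have h1 : L (θ, y) ≤ ε * L₀ y := by
        calc L (θ, y) = ε * (ε⁻¹ * L (θ, y)) := by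
              rw [← mul_assoc, ENNReal.mul_inv_cancel hε hε', one_mul]
          _ ≤ _ := by gcongr
      calc ψ y * L₀ y ≤ 1 * L₀ y := by gcongr; exact hψ1 y
        _ = L₀ y := one_mul _
        _ ≤ ε * (L₀ y ^ 2 / L (θ, y)) := by
          rcases eq_or_ne (L₀ y) 0 with h0 | h0
          · simp [h0]
          calc L₀ y = ε * (L₀ y ^ 2 / (ε * L₀ y)) := by
                rw [div_eq_mul_inv, ENNReal.mul_inv (Or.inl hε) (Or.inl hε'), sq]
                calc L₀ y = (ε * ε⁻¹) * (L₀ y * (L₀ y)⁻¹) * L₀ y := by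
                      rw [ENNReal.mul_inv_cancel hε hε', ENNReal.mul_inv_cancel h0 (hL₀top y)]
                      simp
                  _ = _ := by ring
            _ ≤ _ := by gcongr
  have hLB : Measurable fun y => ∫⁻ θ in B, L₀ y ^ 2 / L (θ, y) ∂Pr := by
    have : Measurable fun z : Θ × 𝒴 => L₀ z.2 ^ 2 / L z := by fun_prop
    exact this.lintegral_prod_left'
  have hpoint : ∀ y, Pr B * (ψ y * L₀ y) ≤ ε * (∫⁻ θ in B, L₀ y ^ 2 / L (θ, y) ∂Pr) +
      ε⁻¹ * ∫⁻ θ in A, L (θ, y) ∂Pr := by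
    intro y
    have hLy : Measurable fun θ => L (θ, y) := by fun_prop
    calc Pr B * (ψ y * L₀ y) = ∫⁻ θ in B, ψ y * L₀ y ∂Pr := by
          rw [setLIntegral_const, mul_comm]
      _ ≤ ∫⁻ θ in B, (ε * (L₀ y ^ 2 / L (θ, y)) + ε⁻¹ * (ψ y * L (θ, y))) ∂Pr :=
          lintegral_mono fun θ => hpt θ y
      _ = ε * (∫⁻ θ in B, L₀ y ^ 2 / L (θ, y) ∂Pr) +
          ε⁻¹ * (ψ y * ∫⁻ θ in B, L (θ, y) ∂Pr) := by
          rw [lintegral_add_left (by fun_prop), lintegral_const_mul _ (by fun_prop),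
            lintegral_const_mul _ (by fun_prop), lintegral_const_mul _ hLy]
      _ ≤ _ := by gcongr; exact hψ2 y
  have hψm : Measurable ψ := by
    have h1 : Measurable fun y => ∫⁻ θ, L (θ, y) ∂Pr := hL.lintegral_prod_left'
    have h2 : Measurable fun y => ∫⁻ θ in A, L (θ, y) ∂Pr := hL.lintegral_prod_left'
    exact h1.inv.mul h2
  have hLA : Measurable fun y => ∫⁻ θ in A, L (θ, y) ∂Pr := hL.lintegral_prod_left'
  calc Pr B * ∫⁻ y, ψ y * L₀ y ∂ν = ∫⁻ y, Pr B * (ψ y * L₀ y) ∂ν := by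
        rw [lintegral_const_mul _ (f := fun y => ψ y * L₀ y) (hψm.mul hL₀)]
    _ ≤ ∫⁻ y, (ε * (∫⁻ θ in B, L₀ y ^ 2 / L (θ, y) ∂Pr) +
        ε⁻¹ * ∫⁻ θ in A, L (θ, y) ∂Pr) ∂ν := lintegral_mono hpoint
    _ = ε * (∫⁻ y, ∫⁻ θ in B, L₀ y ^ 2 / L (θ, y) ∂Pr ∂ν) +
        ε⁻¹ * ∫⁻ y, ∫⁻ θ in A, L (θ, y) ∂Pr ∂ν := by
        rw [lintegral_add_left (hLB.const_mul _), lintegral_const_mul _ hLB,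
          lintegral_const_mul _ hLA]
    _ = ε * (∫⁻ θ in B, ∫⁻ y, L₀ y ^ 2 / L (θ, y) ∂ν ∂Pr) +
        ε⁻¹ * ∫⁻ θ in A, ∫⁻ y, L (θ, y) ∂ν ∂Pr := by
        have h1 : Measurable (Function.uncurry fun y θ => L₀ y ^ 2 / L (θ, y)) := by
          have := hL.comp measurable_swap
          exact ((hL₀.comp measurable_fst).pow_const 2).div this
        have h2 : Measurable (Function.uncurry fun y θ => L (θ, y)) := hL.comp measurable_swap
        rw [lintegral_lintegral_swap h1.aemeasurable, lintegral_lintegral_swap h2.aemeasurable]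
    _ ≤ ε * (∫⁻ θ in B, C ∂Pr) + ε⁻¹ * ∫⁻ θ in A, 1 ∂Pr := by
        gcongr ε * ?_ + ε⁻¹ * ?_
        · exact setLIntegral_mono' hB hC
        · exact lintegral_mono_ae (ae_restrict_of_ae hL1)
    _ = _ := by simp

/-! ## The Laplace law -/

lemma lintegral_Ioi_laplace {lam : ℝ} (hlam : 0 < lam) :
    ∫⁻ x in Set.Ioi (0 : ℝ), ENNReal.ofReal (lam / 2 * Real.exp (-lam * |x|)) = 1 / 2 := by
  have h1 : ∫⁻ x in Set.Ioi (0 : ℝ), ENNReal.ofReal (lam / 2 * Real.exp (-lam * |x|)) =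
      ∫⁻ x in Set.Ioi (0 : ℝ), ENNReal.ofReal (lam / 2 * Real.exp (-lam * x)) :=
    setLIntegral_congr_fun measurableSet_Ioi fun x hx => by
      simp only [abs_of_pos (Set.mem_Ioi.1 hx)]
  have h2 := integrableOn_exp_mul_Ioi (neg_lt_zero.2 hlam) 0
  rw [h1, ← ofReal_integral_eq_lintegral_ofReal (h2.const_mul _)
    (ae_of_all _ fun x => by positivity), integral_const_mul,
    integral_exp_mul_Ioi (neg_lt_zero.2 hlam) 0]
  rw [show lam / 2 * (-Real.exp (-lam * 0) / -lam) = 1 / 2 by simp; field_simp]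
  rw [ENNReal.ofReal_div_of_pos (by norm_num)]
  simp

lemma isProbabilityMeasure_laplace {lam : ℝ} (hlam : 0 < lam) :
    IsProbabilityMeasure (laplace lam) := by
  refine ⟨?_⟩
  rw [laplace, withDensity_apply _ MeasurableSet.univ, Measure.restrict_univ,
    ← lintegral_add_compl _ (measurableSet_Ioi (a := (0 : ℝ))), lintegral_Ioi_laplace hlam,
    Set.compl_Ioi, setLIntegral_congr Iio_ae_eq_Iic.symm,
    ← (Measure.measurePreserving_neg (volume : Measure ℝ)).setLIntegral_comp_preimage_emb
      (MeasurableEquiv.neg ℝ).measurableEmbedding]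
  simp only [abs_neg, Set.neg_preimage, Set.neg_Iio, neg_zero]
  rw [lintegral_Ioi_laplace hlam]
  exact ENNReal.add_halves 1

lemma laplace_Icc_ge {lam δ : ℝ} (hlam : 0 < lam) (x : ℝ) :
    ENNReal.ofReal (lam * δ * Real.exp (-(lam * |x| + lam * δ))) ≤
      laplace lam (Set.Icc (x - δ) (x + δ)) := by
  rw [laplace, withDensity_apply _ measurableSet_Icc]
  have h : ∀ y ∈ Set.Icc (x - δ) (x + δ),
      ENNReal.ofReal (lam / 2 * Real.exp (-(lam * |x| + lam * δ))) ≤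
        ENNReal.ofReal (lam / 2 * Real.exp (-lam * |y|)) := by
    intro y hy
    refine ENNReal.ofReal_le_ofReal (mul_le_mul_of_nonneg_left (Real.exp_le_exp.2 ?_)
      (by positivity))
    have h1 : |y| ≤ |x| + δ := by
      have h2 : |y - x| ≤ δ := abs_le.2 ⟨by linarith [hy.1], by linarith [hy.2]⟩
      have h3 := abs_sub_abs_le_abs_sub y x
      linarith
    nlinarith
  refine le_trans ?_ (setLIntegral_mono' measurableSet_Icc h)
  rw [setLIntegral_const, Real.volume_Icc, ← ENNReal.ofReal_mul (by positivity)]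
  refine ENNReal.ofReal_le_ofReal (le_of_eq ?_)
  ring

/-! ## The prior on the regression parameter -/

lemma isProbabilityMeasure_slab {p q : ℕ} {lam : ℝ} (hlam : 0 < lam)
    (S : Finset (Fin q × Fin p)) :
    ∀ l, IsProbabilityMeasure (if l ∈ S then laplace lam else Measure.dirac (0 : ℝ)) := by
  intro l
  have := isProbabilityMeasure_laplace hlam
  split_ifs <;> infer_instance

lemma isFiniteMeasure_priorBeta (p q : ℕ) {lam : ℝ} (hlam : 0 < lam) (π : ℕ → ℝ) :
    IsFiniteMeasure (priorBeta p q lam π) := by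
  refine ⟨?_⟩
  rw [priorBeta, Measure.finsetSum_apply]
  refine ENNReal.sum_lt_top.2 fun S _ => ?_
  have := isProbabilityMeasure_slab hlam S
  rw [Measure.smul_apply, measure_univ]
  simp

/-- The coordinatewise neighbourhoods of `β₀`, of radius `δ`, inside the vectors whose support
is contained in that of `β₀`. -/
def supportBox {p q : ℕ} (β₀ : Coef p q) (δ : ℝ) : Set (Coef p q) :=
  Set.univ.pi fun l => if β₀ l ≠ 0 then Set.Icc (β₀ l - δ) (β₀ l + δ) else {0}

lemma measurableSet_supportBox {p q : ℕ} (β₀ : Coef p q) (δ : ℝ) :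
    MeasurableSet (supportBox β₀ δ) := by
  refine MeasurableSet.univ_pi fun l => ?_
  split_ifs
  · exact measurableSet_Icc
  · exact measurableSet_singleton 0

/-- Only the mixture component whose support is exactly that of `β₀` is kept; outside it the Dirac
masses contribute the factor 1. -/
lemma priorBeta_supportBox_ge {p q : ℕ} {lam δ a : ℝ} (hlam : 0 < lam) (hδ : 0 < δ) {π : ℕ → ℝ}
    (hπ : ∀ s, 0 ≤ π s) (β₀ : Coef p q) (ha : ∀ l, lam * |β₀ l| ≤ a) :
    ENNReal.ofReal (π (suppCard β₀) / ((q * p).choose (suppCard β₀) : ℝ) *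
      (lam * δ * Real.exp (-(a + lam * δ))) ^ suppCard β₀) ≤
      priorBeta p q lam π (supportBox β₀ δ) := by
  set S : Finset (Fin q × Fin p) := Finset.univ.filter fun l => β₀ l ≠ 0 with hS
  have := isProbabilityMeasure_slab hlam S
  rw [priorBeta, Measure.finsetSum_apply]
  refine le_trans ?_ (Finset.single_le_sum (fun _ _ => zero_le) (Finset.mem_univ S))
  rw [Measure.smul_apply, smul_eq_mul, supportBox, Measure.pi_pi,
    ENNReal.ofReal_mul (div_nonneg (hπ _) (by positivity)),
    ENNReal.ofReal_pow (by positivity)]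
  change ENNReal.ofReal (π S.card / _) * _ ^ S.card ≤ _
  refine mul_le_mul' le_rfl ?_
  rw [← Finset.prod_const, ← Finset.prod_subset (Finset.subset_univ S)]
  · refine Finset.prod_le_prod' fun l hl => ?_
    have hl' : β₀ l ≠ 0 := (Finset.mem_filter.1 hl).2
    rw [if_pos hl, if_pos hl']
    refine le_trans (ENNReal.ofReal_le_ofReal ?_) (laplace_Icc_ge hlam (β₀ l))
    have := ha l
    gcongr
  · intro l _ hl
    have hl' : ¬ β₀ l ≠ 0 := fun h => hl (Finset.mem_filter.2 ⟨Finset.mem_univ _, h⟩)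
    rw [if_neg hl, if_neg hl']
    simp

/-- In the component indexed by `S`, the vector vanishes off `S` almost surely, so only sets with
more than `R` elements count. Laplace coordinates may vanish on null sets, so only an upper bound is
claimed. Grouping the sets by size cancels the binomial coefficients. -/
lemma priorBeta_suppCard_le {p q : ℕ} {lam R : ℝ} (hlam : 0 < lam) (π : ℕ → ℝ) :
    priorBeta p q lam π {β | R < suppCard β} ≤
      ∑ s ∈ Finset.range (q * p + 1), if R < s then ENNReal.ofReal (π s) else 0 := by
  have h1 : ∀ S : Finset (Fin q × Fin p),
      Measure.pi (fun l => if l ∈ S then laplace lam else Measure.dirac (0 : ℝ))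
        {β | R < suppCard β} ≤ if R < S.card then 1 else 0 := by
    intro S
    have := isProbabilityMeasure_slab hlam S
    split_ifs with h
    · exact prob_le_one
    · have h2 : {β : Coef p q | R < suppCard β} ⊆
          ⋃ l : {l // l ∉ S}, Function.eval l.1 ⁻¹' {0}ᶜ := by
        intro β hβ
        by_contra hcon
        simp only [Set.mem_iUnion, Set.mem_preimage, Function.eval, Set.mem_compl_iff,
          Set.mem_singleton_iff, Subtype.exists, not_exists, not_not] at hcon
        have h3 : suppCard β ≤ S.card := by
          refine Finset.card_le_card fun l hl => ?_
          by_contra hlS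
          exact (Finset.mem_filter.1 hl).2 (hcon l hlS)
        have h4 : (suppCard β : ℝ) ≤ S.card := by exact_mod_cast h3
        exact h ((show R < suppCard β from hβ).trans_le h4)
      refine (measure_mono_null h2 (measure_iUnion_null fun l => ?_)).le
      refine Measure.pi_eval_preimage_null _ ?_
      rw [if_neg l.2]
      simp
  rw [priorBeta, Measure.finsetSum_apply]
  calc _ ≤ ∑ S : Finset (Fin q × Fin p), ENNReal.ofReal (π S.card / ((q * p).choose S.card : ℝ)) *
        (if R < S.card then 1 else 0) := by
        refine Finset.sum_le_sum fun S _ => ?_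
        rw [Measure.smul_apply, smul_eq_mul]
        gcongr
        exact h1 S
    _ = _ := by
        rw [← Finset.powerset_univ, Finset.sum_powerset_apply_card (fun s : ℕ =>
          ENNReal.ofReal (π s / ((q * p).choose s : ℝ)) * (if R < (s : ℝ) then 1 else 0))]
        simp only [Finset.card_univ, Fintype.card_prod, Fintype.card_fin]
        refine Finset.sum_congr rfl fun s hs => ?_
        have hc : 0 < (q * p).choose s :=
          Nat.choose_pos (Nat.lt_succ_iff.1 (Finset.mem_range.1 hs))
        split_ifs
        · rw [mul_one, nsmul_eq_mul, ← ENNReal.ofReal_natCast, ← ENNReal.ofReal_mul (by positivity),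
            mul_div_cancel₀ _ (by positivity)]
        · simp

/-! ## The prior on the dimension -/

/-- If `π 0` were zero, the upper bound would make every weight zero, against total mass 1; the
lower bound then propagates positivity. This makes the prior mass near a truth of any size nonzero,
which permits dividing by it. -/
lemma dimensionPrior_pos {N : ℕ} {π : ℕ → ℝ} {c c' : ℝ} (hc : 0 < c) (hπ : ∀ s, 0 ≤ π s)
    (hsum : ∑ s ∈ Finset.range (N + 1), π s = 1)
    (h : ∀ s, 1 ≤ s → s ≤ N → c * π (s - 1) ≤ π s ∧ π s ≤ c' * π (s - 1)) :
    ∀ s ≤ N, 0 < π s := by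
  have h0 : 0 < π 0 := by
    refine (hπ 0).lt_of_ne' fun h0 => ?_
    have : ∀ s ≤ N, π s = 0 := by
      intro s
      induction s with
      | zero => exact fun _ => h0
      | succ s ih =>
        intro hs
        have h1 := (h (s + 1) (by omega) hs).2
        rw [Nat.add_sub_cancel, ih (by omega), mul_zero] at h1
        exact le_antisymm h1 (hπ _)
    rw [Finset.sum_eq_zero fun s hs => this s (Nat.lt_succ_iff.1 (Finset.mem_range.1 hs))] at hsum
    exact zero_ne_one hsum
  intro s
  induction s with
  | zero => exact fun _ => h0
  | succ s ih =>
    intro hs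
    have h1 := (h (s + 1) (by omega) hs).1
    rw [Nat.add_sub_cancel] at h1
    exact (mul_pos hc (ih (by omega))).trans_le h1

lemma dimensionPrior_le {N s₀ : ℕ} {π : ℕ → ℝ} {c : ℝ} (hc : 0 ≤ c)
    (h : ∀ s, 1 ≤ s → s ≤ N → π s ≤ c * π (s - 1)) :
    ∀ k, s₀ + k ≤ N → π (s₀ + k) ≤ c ^ k * π s₀ := by
  intro k
  induction k with
  | zero => simp
  | succ k ih =>
    intro hk
    calc π (s₀ + (k + 1)) ≤ c * π (s₀ + k) := h _ (by omega) hk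
      _ ≤ c * (c ^ k * π s₀) := by gcongr; exact ih (by omega)
      _ = _ := by ring

/-- The tail is measured relative to `π s₀`, the factor that also appears in the mass near the
truth. Each of the `q * p + 1` sizes is bounded crudely by the decay between `s₀` and `R`. -/
lemma priorBeta_suppCard_le_of_decay {p q s₀ : ℕ} {lam R P a : ℝ} (hlam : 0 < lam) {π : ℕ → ℝ}
    (hP : 1 ≤ P) (ha : 0 ≤ a) (hπ : 0 ≤ π s₀) (hR : (s₀ : ℝ) ≤ R)
    (h : ∀ s, 1 ≤ s → s ≤ q * p → π s ≤ P ^ (-a) * π (s - 1)) :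
    priorBeta p q lam π {β | R < suppCard β} ≤
      ENNReal.ofReal ((q * p + 1) * (P ^ (-a * (R - s₀)) * π s₀)) := by
  have hP0 : 0 < P := by linarith
  calc _ ≤ _ := priorBeta_suppCard_le hlam π
    _ ≤ ∑ s ∈ Finset.range (q * p + 1), ENNReal.ofReal (P ^ (-a * (R - s₀)) * π s₀) := by
        refine Finset.sum_le_sum fun s hs => ?_
        split_ifs with hRs
        · refine ENNReal.ofReal_le_ofReal ?_
          obtain ⟨k, rfl⟩ := Nat.exists_eq_add_of_le
            (show s₀ ≤ s by exact_mod_cast hR.trans hRs.le)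
          refine (dimensionPrior_le (by positivity) h k
            (Nat.lt_succ_iff.1 (Finset.mem_range.1 hs))).trans ?_
          gcongr
          rw [← Real.rpow_natCast, ← Real.rpow_mul hP0.le]
          refine Real.rpow_le_rpow_of_exponent_le hP ?_
          push_cast at hRs
          nlinarith
        · exact zero_le
    _ = _ := by
        rw [Finset.sum_const, Finset.card_range, nsmul_eq_mul, ← ENNReal.ofReal_natCast,
          ← ENNReal.ofReal_mul (by positivity)]
        push_cast
        rfl

/-! ## The mean function is Lipschitz -/

lemma norm_col_le_starNorm {ι κ : Type*} [Fintype ι] [Finite κ] (A : Matrix ι κ ℝ) (j : κ) :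
    ‖(WithLp.toLp 2 fun i => A i j : EuclideanSpace ℝ ι)‖ ≤ starNorm A := by
  rw [EuclideanSpace.norm_eq]
  simp only [Real.norm_eq_abs, sq_abs]
  exact le_ciSup (f := fun j => √(∑ i, A i j ^ 2)) (Set.finite_range _).bddAbove j

lemma starNorm_nonneg {ι κ : Type*} [Fintype ι] (A : Matrix ι κ ℝ) : 0 ≤ starNorm A :=
  Real.iSup_nonneg fun _ => Real.sqrt_nonneg _

lemma norm_mulVec_le_starNorm {ι κ : Type*} [Fintype ι] [Fintype κ] (A : Matrix ι κ ℝ)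
    (v : κ → ℝ) :
    ‖(WithLp.toLp 2 (A *ᵥ v) : EuclideanSpace ℝ ι)‖ ≤ starNorm A * ∑ j, |v j| := by
  have h : (WithLp.toLp 2 (A *ᵥ v) : EuclideanSpace ℝ ι) =
      ∑ j, v j • (WithLp.toLp 2 fun i => A i j : EuclideanSpace ℝ ι) := by
    ext i
    simp [Matrix.mulVec, dotProduct, mul_comm]
  rw [h, Finset.mul_sum]
  refine (norm_sum_le _ _).trans (Finset.sum_le_sum fun j _ => ?_)
  rw [norm_smul, Real.norm_eq_abs, mul_comm]
  gcongr
  exact norm_col_le_starNorm A j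

/-- Summing the Lipschitz bound over observations and subjects yields `K² M ‖X (β - β₀)‖²`, and
expanding `X v` in the columns of `X` bounds its norm by `‖X‖_*` times the `ℓ¹` norm of `v`. -/
lemma sum_norm_mean_sub_sq_le {n p q r M : ℕ} (D : Design n p q r)
    {f : EuclideanSpace ℝ (Fin q) → ℝ → ℝ} {K : ℝ}
    (hf : ∀ x y : EuclideanSpace ℝ (Fin q), ∀ t : ℝ, |f x t - f y t| ≤ K * ‖x - y‖)
    (hM : ∀ i, D.m i ≤ M) (β β₀ : Coef p q) :
    ∑ i, ‖D.mean f β i - D.mean f β₀ i‖ ^ 2 ≤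
      (√(K ^ 2 * M) * (starNorm D.stackedX * ∑ l, |β l - β₀ l|)) ^ 2 := by
  have h1 : ∀ i, ‖D.mean f β i - D.mean f β₀ i‖ ^ 2 ≤
      K ^ 2 * M * ∑ k, ((D.X i *ᵥ (β - β₀)) k) ^ 2 := by
    intro i
    have h2 : ∀ j, ((D.mean f β i - D.mean f β₀ i) j) ^ 2 ≤
        K ^ 2 * ∑ k, ((D.X i *ᵥ (β - β₀)) k) ^ 2 := by
      intro j
      have h3 := hf (WithLp.toLp 2 (D.X i *ᵥ β)) (WithLp.toLp 2 (D.X i *ᵥ β₀)) (D.t i j)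
      rw [← WithLp.toLp_sub, ← Matrix.mulVec_sub] at h3
      have h4 := pow_le_pow_left₀ (abs_nonneg _) h3 2
      rw [sq_abs, mul_pow, EuclideanSpace.real_norm_sq_eq] at h4
      exact h4
    rw [EuclideanSpace.real_norm_sq_eq]
    calc _ ≤ ∑ _j : Fin (D.m i), K ^ 2 * ∑ k, ((D.X i *ᵥ (β - β₀)) k) ^ 2 :=
          Finset.sum_le_sum fun j _ => h2 j
      _ = (D.m i : ℝ) * (K ^ 2 * ∑ k, ((D.X i *ᵥ (β - β₀)) k) ^ 2) := by simp
      _ ≤ (M : ℝ) * (K ^ 2 * ∑ k, ((D.X i *ᵥ (β - β₀)) k) ^ 2) := by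
          have : 0 ≤ ∑ k, ((D.X i *ᵥ (β - β₀)) k) ^ 2 := Finset.sum_nonneg fun _ _ => sq_nonneg _
          gcongr
          exact hM i
      _ = _ := by ring
  have h5 := norm_mulVec_le_starNorm D.stackedX (β - β₀)
  have h6 := pow_le_pow_left₀ (norm_nonneg _) h5 2
  rw [EuclideanSpace.real_norm_sq_eq, Fintype.sum_prod_type] at h6
  rw [mul_pow, Real.sq_sqrt (by positivity)]
  calc _ ≤ ∑ i, K ^ 2 * M * ∑ k, ((D.X i *ᵥ (β - β₀)) k) ^ 2 := Finset.sum_le_sum fun i _ => h1 i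
    _ = K ^ 2 * M * ∑ i, ∑ k, ((D.X i *ᵥ (β - β₀)) k) ^ 2 := by rw [Finset.mul_sum]
    _ ≤ _ := by
        gcongr
        exact h6

lemma sum_abs_sub_le_of_mem_supportBox {p q : ℕ} {β β₀ : Coef p q} {δ : ℝ}
    (hβ : β ∈ supportBox β₀ δ) : ∑ l, |β l - β₀ l| ≤ suppCard β₀ * δ := by
  have h : ∀ l, |β l - β₀ l| ≤ if β₀ l ≠ 0 then δ else 0 := by
    intro l
    have hl := hβ l (Set.mem_univ l)
    simp only at hl
    split_ifs at hl ⊢ with h0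
    · exact abs_le.2 ⟨by linarith [hl.1], by linarith [hl.2]⟩
    · rw [Set.mem_singleton_iff] at hl
      rw [hl, not_not.1 h0]
      simp
  refine (Finset.sum_le_sum fun l _ => h l).trans_eq ?_
  rw [← Finset.sum_filter, Finset.sum_const, nsmul_eq_mul]
  rfl

/-! ## Eigenvalue bounds and the Loewner order -/

open scoped MatrixOrder in
lemma trueGamma_bounds {r : ℕ} {lo hi : ℝ} {Γ : Mat r} (hΓ : Γ ∈ trueGamma r lo hi) :
    (Γ - lo • (1 : Mat r)).PosSemidef ∧ (hi • (1 : Mat r) - Γ).PosSemidef := by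
  obtain ⟨hpos, hlo, hhi⟩ := hΓ
  -- Finiteness bounds the spectrum, without which the real `sInf` and `sSup` would be default
  -- values that carry no information.
  have hfin : (spectrum ℝ Γ).Finite := by
    rw [hpos.isHermitian.spectrum_real_eq_range_eigenvalues]
    exact Set.finite_range _
  constructor
  · have h : algebraMap ℝ (Mat r) lo ≤ Γ :=
      (algebraMap_le_iff_le_spectrum hpos.isHermitian).2 fun x hx =>
        hlo.trans (csInf_le hfin.bddBelow hx)
    rwa [Algebra.algebraMap_eq_smul_one, Matrix.le_iff] at h
  · have h : Γ ≤ algebraMap ℝ (Mat r) hi :=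
      (le_algebraMap_iff_spectrum_le hpos.isHermitian).2 fun x hx =>
        (le_csSup hfin.bddAbove hx).trans hhi
    rwa [Algebra.algebraMap_eq_smul_one, Matrix.le_iff] at h

lemma posSemidef_abs_apply_le {r : ℕ} {A : Mat r} (hA : A.PosSemidef) (i j : Fin r) :
    |A i j| ≤ (A i i + A j j) / 2 := by
  have h : ∀ s : ℝ, 0 ≤ A i i + s * A i j + s * (A j i + s * A j j) := by
    intro s
    have := hA.dotProduct_mulVec_nonneg (Pi.single i 1 + s • Pi.single j 1)
    simp only [star_trivial, Matrix.mulVec_add, Matrix.mulVec_smul, dotProduct_add,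
      add_dotProduct, dotProduct_smul, smul_dotProduct, Matrix.mulVec_single_one,
      single_one_dotProduct, Matrix.col_apply, smul_eq_mul] at this
    linarith
  have hs : A j i = A i j := by
    have := hA.isHermitian.apply i j
    simpa using this
  have h1 := h 1
  have h2 := h (-1)
  rw [hs] at h1 h2
  exact abs_le.2 ⟨by linarith, by linarith⟩

lemma trueGamma_abs_apply_le {r : ℕ} {lo hi : ℝ} {Γ : Mat r} (hΓ : Γ ∈ trueGamma r lo hi)
    (i j : Fin r) : |Γ i j| ≤ hi := by
  have h1 := posSemidef_abs_apply_le hΓ.1.posSemidef i j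
  have h2 : ∀ k, Γ k k ≤ hi := fun k => by
    have := (trueGamma_bounds hΓ).2.diag_nonneg (i := k)
    simpa using this
  linarith [h2 i, h2 j]

/-- Entries bounded by `δ` give a quadratic form bounded by `r δ ‖x‖²`, by `|x i| |x j| ≤ (x i² + x
j²) / 2`. -/
lemma posSemidef_smul_one_add {r : ℕ} {E : Mat r} {δ : ℝ} (hE : E.transpose = E)
    (h : ∀ i j, |E i j| ≤ δ) : ((r * δ) • (1 : Mat r) + E).PosSemidef := by
  refine Matrix.PosSemidef.of_dotProduct_mulVec_nonneg ?_ fun x => ?_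
  · rw [Matrix.IsHermitian, Matrix.conjTranspose_eq_transpose_of_trivial, Matrix.transpose_add,
      Matrix.transpose_smul, Matrix.transpose_one, hE]
  · have h1 : |x ⬝ᵥ (E *ᵥ x)| ≤ r * δ * (x ⬝ᵥ x) := by
      have h2 : x ⬝ᵥ (E *ᵥ x) = ∑ i, ∑ j, x i * (E i j * x j) := by
        simp [dotProduct, Matrix.mulVec, Finset.mul_sum]
      have h3 : ∀ i j, |x i * (E i j * x j)| ≤ δ * ((x i * x i + x j * x j) / 2) := by
        intro i j
        have h4 : |x i| * |x j| ≤ (x i * x i + x j * x j) / 2 := by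
          nlinarith [sq_nonneg (|x i| - |x j|), abs_mul_abs_self (x i), abs_mul_abs_self (x j)]
        calc |x i * (E i j * x j)| = |E i j| * (|x i| * |x j|) := by
              rw [abs_mul, abs_mul]; ring
          _ ≤ δ * (|x i| * |x j|) := by gcongr; exact h i j
          _ ≤ _ := mul_le_mul_of_nonneg_left h4 ((abs_nonneg _).trans (h i j))
      rw [h2]
      refine (Finset.abs_sum_le_sum_abs _ _).trans ?_
      calc _ ≤ ∑ i, ∑ j, δ * ((x i * x i + x j * x j) / 2) :=
            Finset.sum_le_sum fun i _ => (Finset.abs_sum_le_sum_abs _ _).trans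
              (Finset.sum_le_sum fun j _ => h3 i j)
        _ = r * δ * (x ⬝ᵥ x) := by
            simp only [dotProduct, ← Finset.mul_sum, ← Finset.sum_div, Finset.sum_add_distrib,
              Finset.sum_const, Finset.card_univ, Fintype.card_fin, nsmul_eq_mul]
            rw [Finset.sum_congr rfl fun i _ => mul_left_comm (x i) (r : ℝ) (x i),
              ← Finset.mul_sum]
            ring
    have h5 := neg_abs_le (x ⬝ᵥ (E *ᵥ x))
    simp only [star_trivial, Matrix.add_mulVec, Matrix.smul_mulVec, Matrix.one_mulVec,
      dotProduct_add, dotProduct_smul, smul_eq_mul]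
    linarith

/-! ## Neighbourhoods of the true covariance matrix -/

/-- The symmetric matrices whose entries are within `lo * u / r` of those of `(1 + u) • Γ₀`. -/
def gammaBox {r : ℕ} (lo u : ℝ) (Γ₀ : Mat r) : Set (Mat r) :=
  {Γ | Γ.transpose = Γ ∧ ∀ i j, |Γ i j - (1 + u) * Γ₀ i j| ≤ lo * u / r}

lemma measurableSet_gammaBox {r : ℕ} (lo u : ℝ) (Γ₀ : Mat r) :
    MeasurableSet (gammaBox lo u Γ₀) := by
  refine IsClosed.measurableSet (IsClosed.inter ?_ ?_)
  · exact isClosed_eq continuous_id.matrix_transpose continuous_id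
  · change IsClosed {Γ : Mat r | ∀ i j, |Γ i j - (1 + u) * Γ₀ i j| ≤ lo * u / r}
    simp only [Set.ofPred_forall]
    refine isClosed_iInter fun i => isClosed_iInter fun j => isClosed_le ?_ continuous_const
    exact ((continuous_id.matrix_elem i j).sub continuous_const).abs

lemma gammaBox_bounds {r : ℕ} {lo hi u : ℝ} (hu : 0 ≤ u) {Γ₀ Γ : Mat r}
    (hΓ₀ : Γ₀ ∈ trueGamma r lo hi) (hΓ : Γ ∈ gammaBox lo u Γ₀) :
    (Γ - Γ₀).PosSemidef ∧ ((1 + 2 * u) • Γ₀ - Γ).PosSemidef := by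
  have h0 := (trueGamma_bounds hΓ₀).1.smul hu
  set E : Mat r := Γ - (1 + u) • Γ₀ with hE
  have hEt : E.transpose = E := by
    rw [hE, Matrix.transpose_sub, Matrix.transpose_smul, hΓ.1, transpose_of_posDef hΓ₀.1]
  have hEδ : ∀ i j, |E i j| ≤ lo * u / r := hΓ.2
  have hEδ' : ∀ i j, |(-E) i j| ≤ lo * u / r := fun i j => by
    rw [Matrix.neg_apply, abs_neg]; exact hEδ i j
  -- For `r = 0` the radius `lo * u / r` is 0 by convention and the cancellation below fails, but
  -- all matrices are then equal.
  rcases Nat.eq_zero_or_pos r with hr | hr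
  · subst hr
    have h1 : (0 : Mat 0).PosSemidef := Matrix.PosSemidef.zero
    exact ⟨by rwa [Subsingleton.elim (Γ - Γ₀) 0],
      by rwa [Subsingleton.elim ((1 + 2 * u) • Γ₀ - Γ) 0]⟩
  have hr' : (r : ℝ) * (lo * u / r) = u * lo := by field_simp
  have h1 := posSemidef_smul_one_add hEt hEδ
  have h2 := posSemidef_smul_one_add (E := -E) (by rw [Matrix.transpose_neg, hEt]) hEδ'
  rw [hr'] at h1 h2
  -- With `E = Γ - (1 + u) Γ₀`, the two differences are `u (Γ₀ - lo) + (u lo ± E)`. Centring the box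
  -- at `(1 + u) Γ₀` rather than at `Γ₀` is what places all of it above `Γ₀`.
  constructor
  · convert h0.add h1 using 1
    rw [hE]
    module
  · convert h0.add h2 using 1
    rw [hE]
    module

lemma measurable_symmetricOf (r : ℕ) : Measurable (symmetricOf (r := r)) := by
  refine measurable_pi_lambda _ fun i => measurable_pi_lambda _ fun j => ?_
  unfold symmetricOf
  simp only [Matrix.of_apply]
  split_ifs
  · exact measurable_pi_apply _
  · exact measurable_pi_apply _

lemma symmetricOf_transpose {r : ℕ} (x : {ij : Fin r × Fin r // ij.1 ≤ ij.2} → ℝ) :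
    (symmetricOf x).transpose = symmetricOf x := by
  ext i j
  simp only [symmetricOf, Matrix.transpose_apply, Matrix.of_apply]
  rcases lt_trichotomy i j with h | h | h
  · rw [dif_neg h.not_ge, dif_pos h.le]
  · subst h; rfl
  · rw [dif_pos h.le, dif_neg h.not_ge]

lemma lebesgueSymm_gammaBox_ge {r : ℕ} {lo u : ℝ} {Γ₀ : Mat r}
    (hΓ₀ : Γ₀.transpose = Γ₀) :
    ENNReal.ofReal (2 * (lo * u / r)) ^ Fintype.card {ij : Fin r × Fin r // ij.1 ≤ ij.2} ≤
      lebesgueSymm r (gammaBox lo u Γ₀) := by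
  rw [lebesgueSymm, Measure.map_apply (measurable_symmetricOf r) (measurableSet_gammaBox _ _ _)]
  calc _ = volume (Set.univ.pi fun ij : {ij : Fin r × Fin r // ij.1 ≤ ij.2} =>
        Set.Icc ((1 + u) * Γ₀ ij.1.1 ij.1.2 - lo * u / r)
          ((1 + u) * Γ₀ ij.1.1 ij.1.2 + lo * u / r)) := by
        rw [volume_pi_pi]
        simp only [Real.volume_Icc]
        rw [← Finset.card_univ, ← Finset.prod_const]
        refine Finset.prod_congr rfl fun _ _ => ?_
        ring_nf
    _ ≤ _ := by
        refine measure_mono fun x hx => ⟨symmetricOf_transpose x, fun i j => ?_⟩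
        have hx' : ∀ i j (h : i ≤ j), |x ⟨(i, j), h⟩ - (1 + u) * Γ₀ i j| ≤ lo * u / r := by
          intro i j h
          have := hx ⟨(i, j), h⟩ (Set.mem_univ _)
          exact abs_le.2 ⟨by linarith [this.1], by linarith [this.2]⟩
        simp only [symmetricOf, Matrix.of_apply]
        split_ifs with h
        · exact hx' i j h
        · have h1 : Γ₀ i j = Γ₀ j i := by
            conv_lhs => rw [← hΓ₀]
            rfl
          rw [h1]
          exact hx' j i _

/-! ## The inverse-Wishart prior -/

lemma continuousOn_invWishartWeight {r : ℕ} (d : ℝ) (Sig : Mat r) :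
    ContinuousOn (invWishartWeight d Sig) {Γ | Γ.PosDef} := by
  have hdet : Continuous fun Γ : Mat r => Γ.det := continuous_id.matrix_det
  have hinv : ContinuousOn (fun Γ : Mat r => Γ⁻¹) {Γ | Γ.PosDef} := by
    simp only [Matrix.inv_def, Ring.inverse_eq_inv']
    exact (hdet.continuousOn.inv₀ fun Γ hΓ => (Matrix.PosDef.det_pos hΓ).ne').smul
      continuous_id.matrix_adjugate.continuousOn
  unfold invWishartWeight
  refine (hdet.continuousOn.rpow_const fun Γ hΓ => Or.inl (Matrix.PosDef.det_pos hΓ).ne').mul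
    (Real.continuous_exp.comp_continuousOn (continuousOn_const.mul ?_))
  have h1 : Continuous fun A : Mat r => (Sig * A).trace :=
    (continuous_const.matrix_mul continuous_id).matrix_trace
  exact h1.comp_continuousOn hinv

/-- These matrices form a compact subset of the positive definite cone, on which the weight is
continuous and positive; hence one lower bound serves all true covariances at once. -/
lemma exists_pos_le_invWishartWeight {r : ℕ} (d : ℝ) (Sig : Mat r) {lo : ℝ} (hlo : 0 < lo)
    (M : ℝ) : ∃ w : ℝ, 0 < w ∧ ∀ Γ : Mat r, (Γ - lo • (1 : Mat r)).PosSemidef →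
      (∀ i j, |Γ i j| ≤ M) → w ≤ invWishartWeight d Sig Γ := by
  set S : Set (Mat r) := {Γ | (Γ - lo • (1 : Mat r)).PosSemidef ∧ ∀ i j, |Γ i j| ≤ M} with hS
  have hpos : ∀ Γ ∈ S, Γ.PosDef := fun Γ hΓ =>
    PosDef.of_le (Matrix.PosDef.one.smul hlo) hΓ.1
  have hw : ∀ Γ ∈ S, 0 < invWishartWeight d Sig Γ := fun Γ hΓ => by
    have := (hpos Γ hΓ).det_pos
    unfold invWishartWeight
    positivity
  have hS' : S = {Γ | Γ.transpose = Γ} ∩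
      (⋂ x : Fin r → ℝ, {Γ : Mat r | 0 ≤ x ⬝ᵥ ((Γ - lo • (1 : Mat r)) *ᵥ x)}) ∩
      {Γ | ∀ i j, |Γ i j| ≤ M} := by
    ext Γ
    simp only [hS, Set.mem_inter_iff, Set.mem_iInter, Set.mem_ofPred_eq]
    refine and_congr_left fun _ => ⟨fun h => ⟨?_, fun x => ?_⟩, fun h => ?_⟩
    · have := h.isHermitian
      rw [Matrix.IsHermitian, Matrix.conjTranspose_eq_transpose_of_trivial,
        Matrix.transpose_sub, Matrix.transpose_smul, Matrix.transpose_one] at this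
      exact sub_left_injective this
    · simpa using h.dotProduct_mulVec_nonneg x
    · refine Matrix.PosSemidef.of_dotProduct_mulVec_nonneg ?_ fun x => by simpa using h.2 x
      rw [Matrix.IsHermitian, Matrix.conjTranspose_eq_transpose_of_trivial,
        Matrix.transpose_sub, Matrix.transpose_smul, Matrix.transpose_one, h.1]
  have hcomp : IsCompact S := by
    rw [hS']
    refine IsCompact.inter_left ?_ (IsClosed.inter ?_ ?_)
    · have h1 : IsCompact (Set.univ.pi fun _ : Fin r => Set.univ.pi fun _ : Fin r =>
          Set.Icc (-M) M) := isCompact_univ_pi fun _ => isCompact_univ_pi fun _ => isCompact_Icc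
      have h2 : (Set.univ.pi fun _ : Fin r => Set.univ.pi fun _ : Fin r => Set.Icc (-M) M) =
          {Γ | ∀ i j, |Γ i j| ≤ M} := by
        ext Γ
        exact ⟨fun h i j => abs_le.2 (h i trivial j trivial), fun h i _ j _ => abs_le.1 (h i j)⟩
      rw [h2] at h1
      exact h1
    · exact isClosed_eq continuous_id.matrix_transpose continuous_id
    · refine isClosed_iInter fun x => isClosed_le continuous_const ?_
      exact continuous_const.dotProduct
        ((continuous_id.sub continuous_const).matrix_mulVec continuous_const)
  rcases S.eq_empty_or_nonempty with h0 | hne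
  · refine ⟨1, one_pos, fun Γ h1 h2 => ?_⟩
    have : Γ ∈ S := ⟨h1, h2⟩
    rw [h0] at this
    exact this.elim
  · obtain ⟨Γ, hΓ, hmin⟩ := hcomp.exists_isMinOn hne
      ((continuousOn_invWishartWeight d Sig).mono hpos)
    exact ⟨_, hw Γ hΓ, fun Γ' h1 h2 => hmin ⟨h1, h2⟩⟩

/-- The inverse-Wishart mass of the neighbourhoods of the true covariance matrix is bounded below
polynomially in their radius. -/
lemma exists_invWishartUnnormalized_gammaBox_ge {r : ℕ} (d : ℝ) (Sig : Mat r)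
    {lo : ℝ} (hlo : 0 < lo) (hi : ℝ) : ∃ w : ℝ, 0 < w ∧ ∀ u : ℝ, 0 ≤ u → u ≤ 1 →
      ∀ Γ₀ ∈ trueGamma r lo hi, ENNReal.ofReal (w *
        (2 * (lo * u / r)) ^ Fintype.card {ij : Fin r × Fin r // ij.1 ≤ ij.2}) ≤
        invWishartUnnormalized d Sig (gammaBox lo u Γ₀) := by
  obtain ⟨w, hw, hw'⟩ := exists_pos_le_invWishartWeight d Sig hlo (2 * hi + lo)
  refine ⟨w, hw, fun u hu hu1 Γ₀ hΓ₀ => ?_⟩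
  have hmeas := measurableSet_gammaBox lo u Γ₀
  have hsub : gammaBox lo u Γ₀ ⊆ {Γ | Γ.PosDef} := fun Γ hΓ =>
    PosDef.of_le hΓ₀.1 (gammaBox_bounds hu hΓ₀ hΓ).1
  have hge : ∀ Γ ∈ gammaBox lo u Γ₀, ENNReal.ofReal w ≤
      ENNReal.ofReal (invWishartWeight d Sig Γ) := by
    intro Γ hΓ
    refine ENNReal.ofReal_le_ofReal (hw' Γ ?_ fun i j => ?_)
    · have := (gammaBox_bounds hu hΓ₀ hΓ).1.add (trueGamma_bounds hΓ₀).1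
      simpa using this
    · have h1 := hΓ.2 i j
      have h2 := trueGamma_abs_apply_le hΓ₀ i j
      have h3 : lo * u / r ≤ lo := by
        have hr : (1 : ℝ) ≤ r := by exact_mod_cast (Fin.pos i)
        rw [div_le_iff₀ (by linarith)]
        nlinarith
      have h4 : |Γ i j| ≤ |Γ i j - (1 + u) * Γ₀ i j| + |(1 + u) * Γ₀ i j| := by
        have := abs_add_le (Γ i j - (1 + u) * Γ₀ i j) ((1 + u) * Γ₀ i j)
        simpa using this
      rw [abs_mul, abs_of_nonneg (by linarith : 0 ≤ 1 + u)] at h4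
      nlinarith [abs_nonneg (Γ₀ i j)]
  rw [invWishartUnnormalized, withDensity_apply _ hmeas, Measure.restrict_restrict hmeas,
    Set.inter_eq_left.2 hsub]
  refine le_trans ?_ (setLIntegral_mono' hmeas hge)
  rw [setLIntegral_const, ENNReal.ofReal_mul hw.le,
    ENNReal.ofReal_pow (by positivity)]
  gcongr
  exact lebesgueSymm_gammaBox_ge (transpose_of_posDef hΓ₀.1)

instance instSFiniteLebesgueSymm (r : ℕ) : SFinite (lebesgueSymm r) := by
  unfold lebesgueSymm
  infer_instance

instance instSFiniteInvWishartUnnormalized {r : ℕ} (d : ℝ) (Sig : Mat r) :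
    SFinite (invWishartUnnormalized d Sig) := by
  unfold invWishartUnnormalized
  infer_instance

instance instSFiniteInvWishart {r : ℕ} (d : ℝ) (Sig : Mat r) :
    SFinite (invWishart d Sig) := by
  unfold invWishart
  infer_instance

lemma ae_posDef_invWishart {r : ℕ} (d : ℝ) (Sig : Mat r) :
    ∀ᵐ Γ ∂invWishart d Sig, Γ.PosDef := by
  refine Measure.ae_smul_measure ?_ _
  exact (withDensity_absolutelyContinuous _ _).ae_le (ae_restrict_mem (measurableSet_posDef r))

/-! ## The chi-square bound for the likelihood -/

/-- Congruence by `Z i` preserves the Loewner order, and the common noise term leaves the slack `(c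
- 1) σ² I`, which is nonnegative since `c ≥ 1`. -/
lemma Delta_order {n p q r : ℕ} (D : Design n p q r) (σ : ℝ) {Γ₀ Γ : Mat r} {c : ℝ}
    (hc : 1 ≤ c) (h : (Γ - Γ₀).PosSemidef) (h' : (c • Γ₀ - Γ).PosSemidef) (i : Fin n) :
    (D.Delta σ Γ i - D.Delta σ Γ₀ i).PosSemidef ∧
      (c • D.Delta σ Γ₀ i - D.Delta σ Γ i).PosSemidef := by
  have h1 := h.mul_mul_conjTranspose_same (D.Z i)
  have h2 := h'.mul_mul_conjTranspose_same (D.Z i)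
  have h3 : (((c - 1) * σ ^ 2) • (1 : Mat (D.m i))).PosSemidef :=
    Matrix.PosSemidef.one.smul (mul_nonneg (by linarith) (sq_nonneg σ))
  rw [Matrix.conjTranspose_eq_transpose_of_trivial] at h1 h2
  constructor
  · convert h1 using 1
    simp only [Design.Delta, Matrix.mul_sub, Matrix.sub_mul]
    abel
  · convert h2.add h3 using 1
    simp only [Design.Delta, Matrix.mul_sub, Matrix.sub_mul, Matrix.mul_smul, Matrix.smul_mul]
    module

/-- Multiplying the bounds for single subjects gives `L₀² / L ≤ C L'`, where `L'` is the likelihood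
with reflected means and true covariances, which integrates to 1. -/
lemma lintegral_likelihood_sq_div_le {n p q r M : ℕ} (D : Design n p q r)
    (f : EuclideanSpace ℝ (Fin q) → ℝ → ℝ) {σ : ℝ} (hσ : 0 < σ) (hM : ∀ i, D.m i ≤ M)
    {β₀ β : Coef p q} {Γ₀ Γ : Mat r} {c : ℝ} (hc : 1 ≤ c) (hΓ₀ : Γ₀.PosDef)
    (h : (Γ - Γ₀).PosSemidef) (h' : (c • Γ₀ - Γ).PosSemidef) {a : ℝ}
    (hβ : ∑ i, ‖D.mean f β i - D.mean f β₀ i‖ ^ 2 ≤ a) :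
    ∫⁻ Y, ENNReal.ofReal (D.likelihood f σ β₀ Γ₀ Y) ^ 2 /
      ENNReal.ofReal (D.likelihood f σ β Γ Y) ≤
      ENNReal.ofReal (c ^ ((n : ℝ) * M / 2) * Real.exp (a / σ ^ 2)) := by
  have hc0 : 0 < c := by linarith
  have hΔ₀ := Delta_posDef D hσ hΓ₀.posSemidef
  have hΔ := Delta_posDef D hσ (PosDef.of_le hΓ₀ h).posSemidef
  set C := c ^ ((n : ℝ) * M / 2) * Real.exp (a / σ ^ 2) with hC
  set L' : D.Data → ℝ := fun Y => ∏ i,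
    gaussianDensity ((2 : ℝ) • D.mean f β₀ i - D.mean f β i) (D.Delta σ Γ₀ i) (Y i) with hL'
  have hL'pos : ∀ Y, 0 < L' Y := fun Y => Finset.prod_pos fun i _ => gaussianDensity_pos _ (hΔ₀ i) _
  have hLpos : ∀ Y, 0 < D.likelihood f σ β Γ Y := fun Y =>
    Finset.prod_pos fun i _ => gaussianDensity_pos _ (hΔ i) _
  have hpt : ∀ Y, D.likelihood f σ β₀ Γ₀ Y ^ 2 ≤ C * L' Y * D.likelihood f σ β Γ Y := by
    intro Y
    have h1 : ∀ i, gaussianDensity (D.mean f β₀ i) (D.Delta σ Γ₀ i) (Y i) ^ 2 ≤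
        c ^ ((M : ℝ) / 2) * Real.exp (‖D.mean f β i - D.mean f β₀ i‖ ^ 2 / σ ^ 2) *
        (gaussianDensity ((2 : ℝ) • D.mean f β₀ i - D.mean f β i) (D.Delta σ Γ₀ i) (Y i) *
          gaussianDensity (D.mean f β i) (D.Delta σ Γ i) (Y i)) := by
      intro i
      have hord := Delta_order D σ hc h h' i
      refine (gaussianDensity_sq_le _ (D.mean f β i) hc0 (by positivity : 0 < σ ^ 2) (hΔ₀ i)
        (Delta_sub_posSemidef D σ hΓ₀.posSemidef i) hord.1 hord.2 (Y i)).trans ?_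
      have := gaussianDensity_pos ((2 : ℝ) • D.mean f β₀ i - D.mean f β i) (hΔ₀ i) (Y i)
      have := gaussianDensity_pos (D.mean f β i) (hΔ i) (Y i)
      gcongr
      exact hM i
    calc D.likelihood f σ β₀ Γ₀ Y ^ 2
        = ∏ i, gaussianDensity (D.mean f β₀ i) (D.Delta σ Γ₀ i) (Y i) ^ 2 := by
          rw [Design.likelihood, Finset.prod_pow]
      _ ≤ _ := Finset.prod_le_prod (fun i _ => sq_nonneg _) fun i _ => h1 i
      _ = c ^ ((n : ℝ) * M / 2) *
            Real.exp ((∑ i, ‖D.mean f β i - D.mean f β₀ i‖ ^ 2) / σ ^ 2) *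
            (L' Y * D.likelihood f σ β Γ Y) := by
          rw [Finset.prod_mul_distrib, Finset.prod_mul_distrib, Finset.prod_mul_distrib,
            Finset.sum_div, Real.exp_sum, Finset.prod_const, Finset.card_univ, Fintype.card_fin,
            ← Real.rpow_natCast, ← Real.rpow_mul hc0.le, Design.likelihood]
          congr 3
          ring
      _ ≤ C * (L' Y * D.likelihood f σ β Γ Y) := by
          have := (hL'pos Y).le
          have := (hLpos Y).le
          rw [hC]
          gcongr
      _ = _ := by ring
  calc _ ≤ ∫⁻ Y, ENNReal.ofReal C * ENNReal.ofReal (L' Y) := by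
        refine lintegral_mono fun Y => ENNReal.div_le_of_le_mul ?_
        have hCpos : 0 ≤ C := by positivity
        have hL₀ : 0 ≤ D.likelihood f σ β₀ Γ₀ Y :=
          Finset.prod_nonneg fun i _ => (gaussianDensity_pos _ (hΔ₀ i) _).le
        rw [← ENNReal.ofReal_mul hCpos, ← ENNReal.ofReal_mul (mul_nonneg hCpos (hL'pos Y).le),
          ← ENNReal.ofReal_pow hL₀]
        exact ENNReal.ofReal_le_ofReal (hpt Y)
    _ = ENNReal.ofReal C := by
        have hm : Measurable fun Y => ENNReal.ofReal (L' Y) :=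
          (Finset.measurable_prod _ fun i _ =>
            (measurable_gaussianDensity _ _).comp (measurable_pi_apply i)).ennreal_ofReal
        rw [lintegral_const_mul _ hm, lintegral_prod_gaussianDensity _ hΔ₀, mul_one]

/-! ## The expected posterior mass for a given design -/

lemma measurable_likelihood_right {n p q r : ℕ} (D : Design n p q r)
    (f : EuclideanSpace ℝ (Fin q) → ℝ → ℝ) (σ : ℝ) (β : Coef p q) (Γ : Mat r) :
    Measurable (D.likelihood f σ β Γ) :=
  Finset.measurable_prod _ fun i _ =>
    (measurable_gaussianDensity _ _).comp (measurable_pi_apply i)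

lemma lintegral_posterior_prior_le {n p q r M : ℕ} (D : Design n p q r)
    {f : EuclideanSpace ℝ (Fin q) → ℝ → ℝ} (hf : ∀ t, Continuous fun x => f x t)
    {σ : ℝ} (hσ : 0 < σ) (hM : ∀ i, D.m i ≤ M) {lam : ℝ} (hlam : 0 < lam) (π : ℕ → ℝ)
    (d : ℝ) (Sig : Mat r) {β₀ : Coef p q} {Γ₀ : Mat r} {c δ a : ℝ}
    (hΓ₀ : Γ₀.PosDef) (hc : 1 ≤ c) {G : Set (Mat r)} (hGm : MeasurableSet G)
    (hG : ∀ Γ ∈ G, (Γ - Γ₀).PosSemidef ∧ (c • Γ₀ - Γ).PosSemidef)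
    (hβ : ∀ β ∈ supportBox β₀ δ, ∑ i, ‖D.mean f β i - D.mean f β₀ i‖ ^ 2 ≤ a)
    (A : Set (Coef p q × Mat r)) {ε : ℝ≥0∞} (hε : ε ≠ 0) (hε' : ε ≠ ∞) :
    prior p q lam π d Sig (supportBox β₀ δ ×ˢ G) *
      ∫⁻ Y, D.posterior f σ (prior p q lam π d Sig) Y A ∂D.law f σ β₀ Γ₀ ≤
      ε * (ENNReal.ofReal (c ^ ((n : ℝ) * M / 2) * Real.exp (a / σ ^ 2)) *
        prior p q lam π d Sig (supportBox β₀ δ ×ˢ G)) +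
      ε⁻¹ * prior p q lam π d Sig A := by
  have := isFiniteMeasure_priorBeta p q hlam π
  set Pr := prior p q lam π d Sig with hPr
  have hSF : SFinite Pr := by rw [hPr, prior]; infer_instance
  have hLm : Measurable fun z : (Coef p q × Mat r) × D.Data =>
      ENNReal.ofReal (D.likelihood f σ z.1.1 z.1.2 z.2) :=
    (measurable_likelihood D hf σ).ennreal_ofReal
  have hL₀m : Measurable fun Y => ENNReal.ofReal (D.likelihood f σ β₀ Γ₀ Y) :=
    (measurable_likelihood_right D f σ β₀ Γ₀).ennreal_ofReal
  have hpos : ∀ᵐ θ ∂Pr, θ.2.PosDef :=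
    Measure.quasiMeasurePreserving_snd.ae (ae_posDef_invWishart d Sig)
  have hL1 : ∀ᵐ θ ∂Pr, ∫⁻ Y, ENNReal.ofReal (D.likelihood f σ θ.1 θ.2 Y) ≤ 1 := by
    filter_upwards [hpos] with θ hθ
    exact (lintegral_prod_gaussianDensity _ fun i => Delta_posDef D hσ hθ.posSemidef i).le
  have hchi : ∀ θ ∈ supportBox β₀ δ ×ˢ G,
      ∫⁻ Y, ENNReal.ofReal (D.likelihood f σ β₀ Γ₀ Y) ^ 2 /
        ENNReal.ofReal (D.likelihood f σ θ.1 θ.2 Y) ≤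
      ENNReal.ofReal (c ^ ((n : ℝ) * M / 2) * Real.exp (a / σ ^ 2)) := fun θ hθ =>
    lintegral_likelihood_sq_div_le D f hσ hM hc hΓ₀ (hG _ hθ.2).1 (hG _ hθ.2).2 (hβ _ hθ.1)
  have hlaw : ∫⁻ Y, D.posterior f σ Pr Y A ∂D.law f σ β₀ Γ₀ ≤
      ∫⁻ Y, (∫⁻ θ, ENNReal.ofReal (D.likelihood f σ θ.1 θ.2 Y) ∂Pr)⁻¹ *
        (∫⁻ θ in A, ENNReal.ofReal (D.likelihood f σ θ.1 θ.2 Y) ∂Pr) *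
        ENNReal.ofReal (D.likelihood f σ β₀ Γ₀ Y) := by
    rw [law_eq_withDensity D f hσ β₀ hΓ₀.posSemidef]
    -- This inequality holds for any integrand, so measurability of the posterior mass in the data
    -- is not needed; likewise `withDensity_apply'` allows an arbitrary `A`.
    refine (lintegral_withDensity_le_lintegral_mul _ hL₀m _).trans (lintegral_mono fun Y => ?_)
    rw [Pi.mul_apply, Design.posterior, Measure.smul_apply, withDensity_apply', smul_eq_mul,
      mul_comm]
  exact (mul_le_mul_right hlaw _).trans (lintegral_posterior_le Pr volume hLm hL₀m
    (fun _ => ENNReal.ofReal_ne_top) hL1 ((measurableSet_supportBox β₀ δ).prod hGm) hchi hε hε')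

/-! ### Prior masses of the neighbourhood and of the large models -/

lemma suppCard_le {p q : ℕ} (β : Coef p q) : suppCard β ≤ q * p := by
  have := Finset.card_le_univ (Finset.univ.filter fun l => β l ≠ 0)
  simpa [suppCard] using this

lemma suppCard_pos {p q : ℕ} {β : Coef p q} (hβ : β ≠ 0) : 1 ≤ suppCard β := by
  obtain ⟨l, hl⟩ := Function.ne_iff.1 hβ
  exact Finset.card_pos.2 ⟨l, Finset.mem_filter.2 ⟨Finset.mem_univ _, hl⟩⟩

/-- The prior mass of the neighbourhoods of a sparse vector with a bounded supremum norm. -/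
lemma priorBeta_supportBox_ge_rpow {p q : ℕ} {lam b L₁ L₂ L₃ E : ℝ} {π : ℕ → ℝ}
    (hp : 1 ≤ p) (hq : 0 < q) (hlam : 0 < lam) (hL₁ : 0 < L₁) (hE : 0 < E)
    (hπ : ∀ s, 0 ≤ π s) {β₀ : Coef p q} (hβ₀ : β₀ ≠ 0) (hb : ‖β₀‖ ≤ b * (lam⁻¹ * Real.log p))
    (hlo : E / (L₁ * (p : ℝ) ^ L₂) ≤ lam) (hhi : lam ≤ L₃ * E)
    (hpL : L₁ * q ^ 2 * Real.exp L₃ ≤ p) :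
    ENNReal.ofReal (π (suppCard β₀) * (p : ℝ) ^ (-(b + L₂ + 3) * suppCard β₀)) ≤
      priorBeta p q lam π (supportBox β₀ (E * suppCard β₀)⁻¹) := by
  set s := suppCard β₀ with hs
  have hs1 : (1 : ℝ) ≤ s := by exact_mod_cast suppCard_pos hβ₀
  have hsq : (s : ℝ) ≤ q * p := by exact_mod_cast suppCard_le β₀
  have hP : (1 : ℝ) ≤ p := by exact_mod_cast hp
  have hP0 : (0 : ℝ) < p := by linarith
  have hQ : (1 : ℝ) ≤ q := by exact_mod_cast hq
  have hlb : ∀ l, lam * |β₀ l| ≤ b * Real.log p := by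
    intro l
    have h1 : |β₀ l| ≤ b * (lam⁻¹ * Real.log p) := (norm_le_pi_norm β₀ l).trans hb
    calc lam * |β₀ l| ≤ lam * (b * (lam⁻¹ * Real.log p)) := by gcongr
      _ = b * Real.log p := by field_simp
  refine le_trans (ENNReal.ofReal_le_ofReal ?_)
    (priorBeta_supportBox_ge hlam (by positivity) hπ β₀ hlb)
  rw [← hs]
  have hδ1 : lam * (E * s)⁻¹ ≤ L₃ := by
    rw [← div_eq_mul_inv, div_le_iff₀ (by positivity)]
    have : 0 ≤ L₃ * E := hlam.le.trans hhi
    nlinarith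
  have hδ2 : (L₁ * q * (p : ℝ) ^ (L₂ + 1))⁻¹ ≤ lam * (E * s)⁻¹ := by
    calc (L₁ * q * (p : ℝ) ^ (L₂ + 1))⁻¹ = E / (L₁ * (p : ℝ) ^ L₂) * (E * (q * p))⁻¹ := by
          rw [Real.rpow_add hP0, Real.rpow_one]
          field_simp
      _ ≤ lam * (E * s)⁻¹ := by gcongr
  -- The exponent per active coordinate: `b` from the Laplace tail at `β₀`, `L₂ + 1` from the width
  -- `lam * δ` with `s ≤ q p`, 1 from the binomial coefficient bounded by `(q p)^s`, and 1 to absorb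
  -- `L₁ q² exp L₃`.
  have hy : ((q : ℝ) * p) * (p : ℝ) ^ (-(b + L₂ + 3)) ≤
      lam * (E * s)⁻¹ * Real.exp (-(b * Real.log p + lam * (E * s)⁻¹)) := by
    have h1 : (p : ℝ) ^ (-b) * Real.exp (-L₃) ≤
        Real.exp (-(b * Real.log p + lam * (E * s)⁻¹)) := by
      rw [Real.rpow_def_of_pos hP0, ← Real.exp_add, Real.exp_le_exp]
      linarith
    refine le_trans ?_ (mul_le_mul hδ2 h1 (by positivity) (by positivity))
    have h2 : (p : ℝ) ^ (-(b + L₂ + 3)) = (p : ℝ) ^ (-b) * (p : ℝ)⁻¹ * (p : ℝ)⁻¹ *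
        ((p : ℝ) ^ (L₂ + 1))⁻¹ := by
      rw [← Real.rpow_neg_one, ← Real.rpow_neg hP0.le, ← Real.rpow_add hP0, ← Real.rpow_add hP0,
        ← Real.rpow_add hP0]
      congr 1
      ring
    have h3 : (q : ℝ) * (p : ℝ)⁻¹ ≤ (L₁ * q)⁻¹ * Real.exp (-L₃) := by
      rw [Real.exp_neg, ← mul_inv, ← div_eq_mul_inv, div_le_iff₀ hP0, inv_mul_eq_div,
        le_div_iff₀ (by positivity)]
      calc _ = L₁ * q ^ 2 * Real.exp L₃ := by ring
        _ ≤ _ := hpL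
    rw [h2]
    calc ((q : ℝ) * p) * ((p : ℝ) ^ (-b) * (p : ℝ)⁻¹ * (p : ℝ)⁻¹ * ((p : ℝ) ^ (L₂ + 1))⁻¹)
        = (q * (p : ℝ)⁻¹) * ((p : ℝ) ^ (-b) * ((p : ℝ) ^ (L₂ + 1))⁻¹) := by
          field_simp
      _ ≤ ((L₁ * q)⁻¹ * Real.exp (-L₃)) * ((p : ℝ) ^ (-b) * ((p : ℝ) ^ (L₂ + 1))⁻¹) := by
          gcongr
      _ = _ := by
          rw [mul_inv, mul_inv, mul_inv]
          ring
  have hchoose : (((q * p).choose s : ℕ) : ℝ) ≤ ((q : ℝ) * p) ^ s := by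
    exact_mod_cast Nat.choose_le_pow (q * p) s
  have hchoose0 : (0 : ℝ) < ((q * p).choose s : ℕ) := by
    exact_mod_cast Nat.choose_pos (suppCard_le β₀)
  rw [Real.rpow_mul hP0.le, Real.rpow_natCast, div_mul_eq_mul_div, le_div_iff₀ hchoose0, mul_assoc]
  refine mul_le_mul_of_nonneg_left ?_ (hπ _)
  calc _ ≤ ((p : ℝ) ^ (-(b + L₂ + 3))) ^ s * ((q : ℝ) * p) ^ s := by gcongr
    _ = (((q : ℝ) * p) * (p : ℝ) ^ (-(b + L₂ + 3))) ^ s := by rw [← mul_pow, mul_comm]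
    _ ≤ _ := by gcongr

/-- The total cost of inflating the covariances by `1 + 1/n` over `n` subjects remains bounded. -/
lemma one_add_rpow_le {n M : ℕ} (hn : 1 ≤ n) :
    (1 + 2 * (1 / (2 * (n : ℝ)))) ^ ((n : ℝ) * M / 2) ≤ Real.exp ((M : ℝ) / 2) := by
  have hn0 : (0 : ℝ) < n := by exact_mod_cast hn
  calc _ ≤ (Real.exp (1 / n)) ^ ((n : ℝ) * M / 2) := by
        refine Real.rpow_le_rpow (by positivity) ?_ (by positivity)
        have := Real.add_one_le_exp (1 / (n : ℝ))
        calc _ = 1 / (n : ℝ) + 1 := by field_simp; ring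
          _ ≤ _ := this
    _ = _ := by
        rw [← Real.exp_mul]
        congr 1
        field_simp

lemma ENNReal_le_of_mul_le {a e x y : ℝ≥0∞} (ha : a ≠ 0) (ha' : a ≠ ∞)
    (h : a * e ≤ x * a + y * a) : e ≤ x + y := by
  rw [← add_mul, mul_comm] at h
  exact (ENNReal.mul_le_mul_iff_left ha ha').1 h


/-- With `u = 1 / (2 n)` the box has side `lo / (r n)`, at least `lo / (r p)`; stating the bound in
`p` makes it comparable with the other prior factors. -/
lemma gammaBox_ge_of_lt {n p r N : ℕ} {d lo hi w : ℝ} {Sig : Mat r} (hn : 1 ≤ n) (hnp : n < p)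
    (hlo : 0 < lo) (hw : 0 < w)
    (hG : ∀ u : ℝ, 0 ≤ u → u ≤ 1 → ∀ Γ₀ ∈ trueGamma r lo hi,
      ENNReal.ofReal (w * (2 * (lo * u / r)) ^ N) ≤
        invWishartUnnormalized d Sig (gammaBox lo u Γ₀))
    {Γ₀ : Mat r} (hΓ₀ : Γ₀ ∈ trueGamma r lo hi) :
    ENNReal.ofReal (w * (lo / r) ^ N * ((p : ℝ) ^ N)⁻¹) ≤
      invWishartUnnormalized d Sig (gammaBox lo (1 / (2 * (n : ℝ))) Γ₀) := by
  have hn0 : (0 : ℝ) < n := by exact_mod_cast hn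
  have hn1 : (1 : ℝ) ≤ n := by exact_mod_cast hn
  have hu1 : 1 / (2 * (n : ℝ)) ≤ 1 := by
    rw [div_le_one (by positivity)]
    linarith
  refine le_trans (ENNReal.ofReal_le_ofReal ?_) (hG _ (by positivity) hu1 Γ₀ hΓ₀)
  rw [mul_assoc, ← inv_pow, ← mul_pow]
  refine mul_le_mul_of_nonneg_left (pow_le_pow_left₀ (by positivity) ?_ N) hw.le
  have : (p : ℝ)⁻¹ ≤ (n : ℝ)⁻¹ := by gcongr
  calc lo / r * (p : ℝ)⁻¹ ≤ lo / r * (n : ℝ)⁻¹ := by gcongr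
    _ = _ := by field_simp

/-- Three spare powers of `1 / p` are kept: one pays for the number of sizes, one for the factor
`ε⁻¹ = p`, and the last is the final rate. Since `s ≥ 1`, the constants `3 + N` are also covered by
a multiple of `s`. -/
lemma rpow_tail_le {P C₁ α g s : ℝ} {N : ℕ} (hP : 1 ≤ P) (hs : 1 ≤ s)
    (hC₁ : g + 3 + N ≤ α * (C₁ - 1)) :
    P ^ (-α * (C₁ * s - s)) ≤ P ^ (-g * s) * (P ^ N)⁻¹ * P⁻¹ * P⁻¹ * P⁻¹ := by
  have hP0 : 0 < P := by linarith
  rw [← Real.rpow_natCast, ← Real.rpow_neg hP0.le, ← Real.rpow_neg_one,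
    ← Real.rpow_add hP0, ← Real.rpow_add hP0, ← Real.rpow_add hP0, ← Real.rpow_add hP0]
  refine Real.rpow_le_rpow_of_exponent_le hP ?_
  have hN0 : (0 : ℝ) ≤ N := by positivity
  have h4 := mul_le_mul_of_nonneg_right hC₁ (by linarith : (0 : ℝ) ≤ s)
  nlinarith

lemma invWishart_univ {r : ℕ} {d : ℝ} {Sig : Mat r}
    (hZ : invWishartUnnormalized d Sig Set.univ ≠ ∞)
    (hZ0 : invWishartUnnormalized d Sig Set.univ ≠ 0) : invWishart d Sig Set.univ = 1 := by
  rw [invWishart, Measure.smul_apply, smul_eq_mul, ENNReal.inv_mul_cancel hZ0 hZ]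

/-- The prior mass of the large models, relative to a lower bound `T` on the unnormalized prior
mass of a neighbourhood of the truth. -/
lemma prior_suppCard_le {p q r N s : ℕ} (hp : 1 ≤ p) (hq : 0 < q) {d : ℝ} {Sig : Mat r}
    (hZ : invWishartUnnormalized d Sig Set.univ ≠ ∞)
    (hZ0 : invWishartUnnormalized d Sig Set.univ ≠ 0)
    {lam α C₁ g W : ℝ} {π : ℕ → ℝ} (hlam : 0 < lam) (hα : 0 < α) (hW : 0 < W) (hs : 1 ≤ s)
    (hπ : ∀ s, 0 ≤ π s)
    (hdecay : ∀ s, 1 ≤ s → s ≤ q * p → π s ≤ (p : ℝ) ^ (-α) * π (s - 1))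
    (hC₁ : 1 ≤ C₁) (hC₁' : g + 3 + N ≤ α * (C₁ - 1)) :
    prior p q lam π d Sig {θ | C₁ * s < suppCard θ.1} ≤
      ENNReal.ofReal (2 * q / W * ((p : ℝ)⁻¹ * (p : ℝ)⁻¹) *
        (π s * (p : ℝ) ^ (-g * s) * (W * ((p : ℝ) ^ N)⁻¹))) := by
  have hs1 : (1 : ℝ) ≤ s := by exact_mod_cast hs
  have hP : (1 : ℝ) ≤ p := by exact_mod_cast hp
  have hP0 : (0 : ℝ) < p := by linarith
  have hQ : (1 : ℝ) ≤ q := by exact_mod_cast hq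
  have hfin := isFiniteMeasure_priorBeta p q hlam π
  have h1 : {θ : Coef p q × Mat r | C₁ * s < suppCard θ.1} =
      {β : Coef p q | C₁ * s < suppCard β} ×ˢ Set.univ := by
    ext θ; simp
  rw [h1, prior, Measure.prod_prod, invWishart_univ hZ hZ0, mul_one]
  refine (priorBeta_suppCard_le_of_decay hlam hP hα.le (hπ s) (by nlinarith)
    hdecay).trans (ENNReal.ofReal_le_ofReal ?_)
  have h2 : (q : ℝ) * p + 1 ≤ 2 * q * p := by nlinarith
  have h3 := rpow_tail_le hP hs1 hC₁'
  have h4 := hπ s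
  calc _ ≤ (2 * q * p) * ((p : ℝ) ^ (-g * s) * ((p : ℝ) ^ N)⁻¹ * (p : ℝ)⁻¹ *
        (p : ℝ)⁻¹ * (p : ℝ)⁻¹ * π s) := by gcongr
    _ = _ := by field_simp

lemma prior_box_ge {p q r : ℕ} {lam d t t' : ℝ} {Sig : Mat r} {π : ℕ → ℝ} (ht : 0 ≤ t)
    (hlam : 0 < lam) {S : Set (Coef p q)} {G : Set (Mat r)}
    (hS : ENNReal.ofReal t ≤ priorBeta p q lam π S)
    (hG : ENNReal.ofReal t' ≤ invWishartUnnormalized d Sig G) :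
    (invWishartUnnormalized d Sig Set.univ)⁻¹ * ENNReal.ofReal (t * t') ≤
      prior p q lam π d Sig (S ×ˢ G) := by
  have hfin := isFiniteMeasure_priorBeta p q hlam π
  rw [prior, Measure.prod_prod, invWishart, Measure.smul_apply, smul_eq_mul,
    ENNReal.ofReal_mul ht, mul_left_comm]
  gcongr

/-- The expected posterior mass of the large models, for given `n`, is of order `1 / p`. -/
lemma lintegral_posterior_suppCard_le {n p q r M N : ℕ} (hn : 1 ≤ n) (hnp : n < p) (hq : 0 < q)
    (hr : 0 < r) (D : Design n p q r) {f : EuclideanSpace ℝ (Fin q) → ℝ → ℝ} {K σ : ℝ}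
    (hf : ∀ x y : EuclideanSpace ℝ (Fin q), ∀ t : ℝ, |f x t - f y t| ≤ K * ‖x - y‖)
    (hσ : 0 < σ) (hM : ∀ i, D.m i ≤ M) {d : ℝ} {Sig : Mat r}
    (hZ : invWishartUnnormalized d Sig Set.univ ≠ ∞)
    {lo hi w : ℝ} (hlo : 0 < lo) (hw : 0 < w)
    (hG : ∀ u : ℝ, 0 ≤ u → u ≤ 1 → ∀ Γ₀ ∈ trueGamma r lo hi,
      ENNReal.ofReal (w * (2 * (lo * u / r)) ^ N) ≤
        invWishartUnnormalized d Sig (gammaBox lo u Γ₀))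
    {lam b L₁ L₂ L₃ c₁ α : ℝ} {π : ℕ → ℝ} (hlam : 0 < lam) (hL₁ : 0 < L₁) (hL₃ : 0 < L₃)
    (hα : 0 < α) (hc₁ : 0 < c₁) (hπ : ∀ s, 0 ≤ π s)
    (hπ1 : ∑ s ∈ Finset.range (q * p + 1), π s = 1)
    (hdecay : ∀ s, 1 ≤ s → s ≤ q * p →
      c₁ * π (s - 1) ≤ π s ∧ π s ≤ (p : ℝ) ^ (-α) * π (s - 1))
    (hlam₁ : starNorm D.stackedX * √(K ^ 2 * M) / (L₁ * (p : ℝ) ^ L₂) ≤ lam)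
    (hlam₂ : lam ≤ L₃ * starNorm D.stackedX * √(K ^ 2 * M) / √n)
    (hpL : L₁ * q ^ 2 * Real.exp L₃ ≤ p) {C₁ : ℝ} (hC₁ : 1 ≤ C₁)
    (hC₁' : b + L₂ + 3 + 3 + N ≤ α * (C₁ - 1))
    {β₀ : Coef p q} (hβ₀ : β₀ ≠ 0) (hb : ‖β₀‖ ≤ b * (lam⁻¹ * Real.log p))
    {Γ₀ : Mat r} (hΓ₀ : Γ₀ ∈ trueGamma r lo hi) :
    ∫⁻ Y, D.posterior f σ (prior p q lam π d Sig) Y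
      {θ | C₁ * suppCard β₀ < suppCard θ.1} ∂D.law f σ β₀ Γ₀ ≤
      ENNReal.ofReal ((Real.exp ((M : ℝ) / 2) * Real.exp (1 / σ ^ 2) +
        2 * q / (w * (lo / r) ^ N) *
          (invWishartUnnormalized d Sig Set.univ).toReal) * (p : ℝ)⁻¹) := by
  obtain ⟨E, hE⟩ : ∃ E, E = starNorm D.stackedX * √(K ^ 2 * M) := ⟨_, rfl⟩
  have hs := suppCard_pos hβ₀
  have hs1 : (1 : ℝ) ≤ suppCard β₀ := by exact_mod_cast hs
  have hn1 : (1 : ℝ) ≤ n := by exact_mod_cast hn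
  have hp : 1 ≤ p := hn.trans hnp.le
  have hP0 : (0 : ℝ) < p := by exact_mod_cast hp
  have hR0 : (0 : ℝ) < r := by exact_mod_cast hr
  have hE0 : 0 ≤ E := hE ▸ mul_nonneg (starNorm_nonneg _) (Real.sqrt_nonneg _)
  have hlamE : lam ≤ L₃ * E := by
    refine hlam₂.trans ?_
    rw [mul_assoc, ← hE]
    exact div_le_self (mul_nonneg hL₃.le hE0) (Real.one_le_sqrt.2 hn1)
  -- A degenerate design or a zero Lipschitz constant would force `lam ≤ 0`.
  have hEpos : 0 < E := by
    rcases hE0.eq_or_lt with h | h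
    · rw [← h, mul_zero] at hlamE
      linarith
    · exact h
  have hcont : ∀ t, Continuous fun x => f x t := fun t =>
    (LipschitzWith.of_dist_le_mul (K := K.toNNReal) fun x y => by
      rw [Real.dist_eq, dist_eq_norm]
      exact (hf x y t).trans (by gcongr; exact Real.le_coe_toNNReal K)).continuous
  have hπs : 0 < π (suppCard β₀) := dimensionPrior_pos hc₁ hπ hπ1 hdecay _ (suppCard_le β₀)
  obtain ⟨W, hW⟩ : ∃ W, W = w * (lo / r) ^ N := ⟨_, rfl⟩
  have hWpos : 0 < W := by rw [hW]; positivity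
  have hGU := gammaBox_ge_of_lt hn hnp hlo hw hG hΓ₀
  rw [← hW] at hGU ⊢
  have hSU := priorBeta_supportBox_ge_rpow hp hq hlam hL₁ hEpos hπ hβ₀ hb (hE ▸ hlam₁) hlamE hpL
  -- The radius `1 / (E s₀)` on `s₀` coordinates gives an `ℓ¹` distance of at most `1 / E`, which
  -- `E` turns into a shift of the means of at most 1.
  have hmean : ∀ β ∈ supportBox β₀ (E * suppCard β₀)⁻¹,
      ∑ i, ‖D.mean f β i - D.mean f β₀ i‖ ^ 2 ≤ 1 := by
    intro β hβ
    refine (sum_norm_mean_sub_sq_le D hf hM β β₀).trans ?_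
    have h1 := sum_abs_sub_le_of_mem_supportBox hβ
    have h2 : √(K ^ 2 * M) * (starNorm D.stackedX * ∑ l, |β l - β₀ l|) ≤ 1 := by
      calc _ = E * ∑ l, |β l - β₀ l| := by rw [hE]; ring
        _ ≤ E * (suppCard β₀ * (E * suppCard β₀)⁻¹) := by gcongr
        _ = 1 := by field_simp
    have h3 : 0 ≤ √(K ^ 2 * M) * (starNorm D.stackedX * ∑ l, |β l - β₀ l|) :=
      mul_nonneg (Real.sqrt_nonneg _) (mul_nonneg (starNorm_nonneg _)
        (Finset.sum_nonneg fun _ _ => abs_nonneg _))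
    exact pow_le_one₀ h3 h2
  have hu0 : 0 ≤ 1 / (2 * (n : ℝ)) := by positivity
  -- The choice `ε = 1 / p` makes the chi-square term `O(1 / p)`, at the price of a factor `p` on
  -- the prior mass of the large models.
  have hmain := lintegral_posterior_prior_le D hcont hσ hM hlam π d Sig
    (c := 1 + 2 * (1 / (2 * (n : ℝ)))) hΓ₀.1 (by linarith)
    (measurableSet_gammaBox lo (1 / (2 * (n : ℝ))) Γ₀)
    (fun Γ hΓ => gammaBox_bounds hu0 hΓ₀ hΓ) hmean {θ | C₁ * suppCard β₀ < suppCard θ.1}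
    (ENNReal.ofReal_pos.2 (inv_pos.2 hP0)).ne' ENNReal.ofReal_ne_top
  have hT := prior_box_ge (by positivity) hlam hSU hGU
  have hZ0 : invWishartUnnormalized d Sig Set.univ ≠ 0 := by
    refine (lt_of_lt_of_le ?_ (hGU.trans (measure_mono (Set.subset_univ _)))).ne'
    rw [ENNReal.ofReal_pos]
    positivity
  have hA := prior_suppCard_le hp hq hZ hZ0 hlam hα hWpos hs hπ
    (fun s h1 h2 => (hdecay s h1 h2).2) hC₁ hC₁'
  have hPrtop : prior p q lam π d Sig (supportBox β₀ (E * suppCard β₀)⁻¹ ×ˢ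
      gammaBox lo (1 / (2 * (n : ℝ))) Γ₀) ≠ ∞ := by
    have hfin := isFiniteMeasure_priorBeta p q hlam π
    rw [prior, Measure.prod_prod]
    refine ENNReal.mul_ne_top (measure_ne_top _ _) (ne_top_of_le_ne_top ENNReal.one_ne_top ?_)
    rw [← invWishart_univ hZ hZ0]
    exact measure_mono (Set.subset_univ _)
  generalize prior p q lam π d Sig (supportBox β₀ (E * suppCard β₀)⁻¹ ×ˢ
    gammaBox lo (1 / (2 * (n : ℝ))) Γ₀) = PB at hmain hT hPrtop
  generalize prior p q lam π d Sig {θ | C₁ * suppCard β₀ < suppCard θ.1} = PA at hmain hA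
  generalize ∫⁻ Y, D.posterior f σ (prior p q lam π d Sig) Y
    {θ | C₁ * suppCard β₀ < suppCard θ.1} ∂D.law f σ β₀ Γ₀ = I at hmain ⊢
  generalize invWishartUnnormalized d Sig Set.univ = Z at hT hZ hZ0 ⊢
  have hTpos : 0 < π (suppCard β₀) * (p : ℝ) ^ (-(b + L₂ + 3) * suppCard β₀) *
      (W * ((p : ℝ) ^ N)⁻¹) := by positivity
  generalize π (suppCard β₀) * (p : ℝ) ^ (-(b + L₂ + 3) * suppCard β₀) *
      (W * ((p : ℝ) ^ N)⁻¹) = T at hT hA hTpos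
  have hPB0 : PB ≠ 0 := (lt_of_lt_of_le
    (ENNReal.mul_pos (ENNReal.inv_ne_zero.2 hZ) (ENNReal.ofReal_pos.2 hTpos).ne') hT).ne'
  -- `T` bounds an unnormalized mass, so the normalizing constant `Z` enters here; this is why it
  -- appears in the final bound.
  have hTZ : ENNReal.ofReal T ≤ Z * PB := by
    calc ENNReal.ofReal T = Z * (Z⁻¹ * ENNReal.ofReal T) := by
          rw [← mul_assoc, ENNReal.mul_inv_cancel hZ0 hZ, one_mul]
      _ ≤ _ := by gcongr
  have hA2 : (ENNReal.ofReal ((p : ℝ)⁻¹))⁻¹ * PA ≤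
      ENNReal.ofReal (2 * q / W * Z.toReal * (p : ℝ)⁻¹) * PB := by
    calc _ ≤ ENNReal.ofReal p * (ENNReal.ofReal (2 * q / W * ((p : ℝ)⁻¹ * (p : ℝ)⁻¹) * T)) := by
          rw [ENNReal.ofReal_inv_of_pos hP0, inv_inv]
          gcongr
      _ = ENNReal.ofReal (2 * q / W * (p : ℝ)⁻¹) * ENNReal.ofReal T := by
          rw [← ENNReal.ofReal_mul hP0.le, ← ENNReal.ofReal_mul (by positivity)]
          congr 1
          field_simp
      _ ≤ ENNReal.ofReal (2 * q / W * (p : ℝ)⁻¹) * (Z * PB) := by gcongr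
      _ = ENNReal.ofReal (2 * q / W * (p : ℝ)⁻¹) * (ENNReal.ofReal Z.toReal * PB) := by
          rw [ENNReal.ofReal_toReal hZ]
      _ = _ := by
          rw [← mul_assoc, ← ENNReal.ofReal_mul (by positivity)]
          congr 2
          ring
  rw [add_mul, ENNReal.ofReal_add (by positivity) (by positivity)]
  refine ENNReal_le_of_mul_le hPB0 hPrtop (hmain.trans (add_le_add ?_ hA2))
  rw [← mul_assoc, ← ENNReal.ofReal_mul (by positivity), mul_comm (Real.exp _ * Real.exp _)]
  gcongr
  exact one_add_rpow_le hn

/-! ## The inverse-Wishart density is integrable -/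

/-- The Schur complement of the lower right block of a positive definite matrix, and its relation
to the determinant and to the trace of the inverse. -/
lemma PosDef.schur {r : ℕ} {A : Mat (r + 1)} (hA : A.PosDef) {C : Mat r} {b u : Fin r → ℝ} {s : ℝ}
    (hC : ∀ i j, A i.succ j.succ = C i j) (hb : ∀ i, A 0 (Fin.succ i) = b i)
    (hb' : ∀ i, A (Fin.succ i) 0 = b i) (hu : u = C⁻¹ *ᵥ b) (hs : s = A 0 0 - b ⬝ᵥ u) :
    C.PosDef ∧ 0 < s ∧ A.det = s * C.det ∧ A⁻¹.trace = C⁻¹.trace + (1 + u ⬝ᵥ u) / s := by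
  have hCeq : A.submatrix Fin.succ Fin.succ = C := by
    ext i j
    exact hC i j
  have hCpos : C.PosDef := hCeq ▸ hA.submatrix (Fin.succ_injective r)
  have hCu : IsUnit C.det := hCpos.det_pos.ne'.isUnit
  have hAu : IsUnit A.det := hA.det_pos.ne'.isUnit
  have hCb : C *ᵥ u = b := by
    rw [hu, Matrix.mulVec_mulVec, Matrix.mul_nonsing_inv _ hCu, Matrix.one_mulVec]
  -- The vector `(1, -u)` is mapped by `A` to `s` times the first basis vector: pairing it with its
  -- image shows `s > 0`, and the first column of `A⁻¹` is `v / s`.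
  set v : Fin (r + 1) → ℝ := Fin.cons 1 (-u) with hv
  have hAv : A *ᵥ v = Pi.single 0 s := by
    ext i
    refine Fin.cases ?_ (fun i => ?_) i
    · simp [Matrix.mulVec, dotProduct, Fin.sum_univ_succ, hv, hb, hs, sub_eq_add_neg]
    · have := congrFun hCb i
      simp only [Matrix.mulVec, dotProduct] at this
      simp [Matrix.mulVec, dotProduct, Fin.sum_univ_succ, hv, hb', hC, this]
  have hv0 : v ≠ 0 := fun h => by
    have := congrFun h 0
    simp [hv] at this
  have hspos : 0 < s := by
    have h := hA.dotProduct_mulVec_pos hv0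
    rw [star_trivial, hAv, dotProduct_single] at h
    simpa [hv] using h
  have hinv0 : ∀ i, A⁻¹ i 0 = v i / s := by
    have h1 : A⁻¹ *ᵥ (A *ᵥ v) = v := by
      rw [Matrix.mulVec_mulVec, Matrix.nonsing_inv_mul _ hAu, Matrix.one_mulVec]
    intro i
    have h2 := congrFun h1 i
    rw [hAv, Matrix.mulVec_single] at h2
    rw [eq_div_iff hspos.ne']
    simpa using h2
  have hCt : C⁻¹.transpose = C⁻¹ := transpose_of_posDef hCpos.inv
  have hinv1 : ∀ j : Fin r, A⁻¹ j.succ j.succ = C⁻¹ j j + u j * u j / s := by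
    intro j
    -- A column of `C⁻¹` padded with 0 solves the system up to `u j` times the first basis vector,
    -- which the first column of `A⁻¹` corrects.
    set z : Fin (r + 1) → ℝ := Fin.cons 0 fun i => C⁻¹ i j with hz
    have hAz : A *ᵥ z = Pi.single 0 (u j) + Pi.single j.succ 1 := by
      ext i
      refine Fin.cases ?_ (fun i => ?_) i
      · have : ∑ x, b x * C⁻¹ x j = u j := by
          rw [hu]
          simp only [Matrix.mulVec, dotProduct]
          refine Finset.sum_congr rfl fun x _ => ?_
          rw [mul_comm]
          congr 1
          conv_lhs => rw [← hCt]
          rfl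
        simp [Matrix.mulVec, dotProduct, Fin.sum_univ_succ, hz, hb, this]
      · have h1 := congrFun (congrFun (Matrix.mul_nonsing_inv C hCu) i) j
        rw [Matrix.mul_apply] at h1
        simp only [Matrix.mulVec, dotProduct, Fin.sum_univ_succ, hz, hC, Fin.cons_zero,
          Fin.cons_succ, mul_zero, zero_add, h1, Pi.add_apply]
        simp [Matrix.one_apply, Pi.single_apply, Fin.succ_inj, Fin.succ_ne_zero]
    have h1 : A⁻¹ *ᵥ (A *ᵥ z) = z := by
      rw [Matrix.mulVec_mulVec, Matrix.nonsing_inv_mul _ hAu, Matrix.one_mulVec]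
    have h2 := congrFun h1 j.succ
    rw [hAz, Matrix.mulVec_add, Matrix.mulVec_single, Matrix.mulVec_single] at h2
    have h3 := hinv0 j.succ
    simp only [hv, hz, Fin.cons_succ, Pi.neg_apply, Pi.add_apply, Pi.smul_apply, Matrix.col_apply,
      MulOpposite.smul_eq_mul_unop, MulOpposite.unop_op, mul_one] at h2 h3
    rw [h3] at h2
    linear_combination h2
  refine ⟨hCpos, hspos, ?_, ?_⟩
  -- The cofactor formula reads the corner entry of `A⁻¹` as `det C / det A`, while the previous
  -- computation gives `1 / s`.
  · have h1 := hinv0 0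
    rw [Matrix.inv_def, Ring.inverse_eq_inv', Matrix.smul_apply,
      Matrix.adjugate_fin_succ_eq_det_submatrix] at h1
    simp only [Fin.succAbove_zero, hCeq, hv, Fin.cons_zero, smul_eq_mul] at h1
    have := hA.det_pos.ne'
    have := hspos.ne'
    field_simp at h1
    simp at h1
    linarith
  · rw [Matrix.trace, Fin.sum_univ_succ]
    simp only [Matrix.diag_apply, hinv0 0, hinv1, hv, Fin.cons_zero, Finset.sum_add_distrib,
      ← Finset.sum_div]
    simp only [Matrix.trace, Matrix.diag_apply, dotProduct]
    ring

/-- The index set of the upper triangular entries, split off its first row. -/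
lemma exists_upperTriangular_equiv (r : ℕ) :
    ∃ e : {ij : Fin r × Fin r // ij.1 ≤ ij.2} ⊕ (Fin r ⊕ Unit) ≃
      {ij : Fin (r + 1) × Fin (r + 1) // ij.1 ≤ ij.2},
      (∀ i j h, e (Sum.inl ⟨(i, j), h⟩) = ⟨(i.succ, j.succ), Fin.succ_le_succ_iff.2 h⟩) ∧
      (∀ j, e (Sum.inr (Sum.inl j)) = ⟨(0, j.succ), Fin.zero_le _⟩) ∧
      ∀ t, e (Sum.inr (Sum.inr t)) = ⟨(0, 0), le_rfl⟩ := by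
  refine ⟨Equiv.ofBijective (Sum.elim
    (fun ij => ⟨(ij.1.1.succ, ij.1.2.succ), Fin.succ_le_succ_iff.2 ij.2⟩)
    (Sum.elim (fun j => ⟨(0, j.succ), Fin.zero_le _⟩) fun _ => ⟨(0, 0), le_rfl⟩)) ⟨?_, ?_⟩,
    fun _ _ _ => rfl, fun _ => rfl, fun _ => rfl⟩
  · rintro (⟨⟨i, j⟩, h⟩ | j | t) (⟨⟨i', j'⟩, h'⟩ | j' | t') <;>
      simp [Fin.succ_ne_zero, (Fin.succ_ne_zero _).symm]
  · rintro ⟨⟨i, j⟩, h⟩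
    induction i using Fin.cases with
    | zero =>
      induction j using Fin.cases with
      | zero => exact ⟨Sum.inr (Sum.inr ()), rfl⟩
      | succ j => exact ⟨Sum.inr (Sum.inl j), rfl⟩
    | succ i =>
      induction j using Fin.cases with
      | zero => exact absurd h (by simp)
      | succ j => exact ⟨Sum.inl ⟨(i, j), Fin.succ_le_succ_iff.1 h⟩, rfl⟩

/-- Lebesgue measure on the symmetric matrices, split off the first row. -/
lemma exists_measurePreserving_symmetricOf (r : ℕ) :
    ∃ φ : ({ij : Fin r × Fin r // ij.1 ≤ ij.2} → ℝ) × ((Fin r → ℝ) × ℝ) →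
      {ij : Fin (r + 1) × Fin (r + 1) // ij.1 ≤ ij.2} → ℝ,
      MeasurePreserving φ ∧ MeasurableEmbedding φ ∧ ∀ y b a,
        (∀ i j, symmetricOf (φ (y, b, a)) (Fin.succ i) (Fin.succ j) = symmetricOf y i j) ∧
        (∀ j, symmetricOf (φ (y, b, a)) 0 (Fin.succ j) = b j) ∧
        (∀ j, symmetricOf (φ (y, b, a)) (Fin.succ j) 0 = b j) ∧
        symmetricOf (φ (y, b, a)) 0 0 = a := by
  obtain ⟨e, he1, he2, he3⟩ := exists_upperTriangular_equiv r
  set g₁ : ((Fin r → ℝ) × ℝ) ≃ᵐ ((Fin r → ℝ) × (Unit → ℝ)) :=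
    (MeasurableEquiv.refl _).prodCongr (MeasurableEquiv.funUnique Unit ℝ).symm with hg₁
  set g₂ : ((Fin r → ℝ) × (Unit → ℝ)) ≃ᵐ (Fin r ⊕ Unit → ℝ) :=
    (MeasurableEquiv.sumPiEquivProdPi fun _ => ℝ).symm with hg₂
  set g₃ : (({ij : Fin r × Fin r // ij.1 ≤ ij.2} → ℝ) × (Fin r ⊕ Unit → ℝ)) ≃ᵐ
    ({ij : Fin r × Fin r // ij.1 ≤ ij.2} ⊕ (Fin r ⊕ Unit) → ℝ) :=
    (MeasurableEquiv.sumPiEquivProdPi fun _ => ℝ).symm with hg₃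
  set g₄ := MeasurableEquiv.piCongrLeft (fun _ => ℝ) e with hg₄
  have h₁ : MeasurePreserving g₁ := (MeasurePreserving.id _).prod
    (volume_preserving_funUnique Unit ℝ).symm
  have h₂ : MeasurePreserving g₂ := volume_measurePreserving_sumPiEquivProdPi_symm _
  have h₃ : MeasurePreserving g₃ := volume_measurePreserving_sumPiEquivProdPi_symm _
  have h₄ : MeasurePreserving g₄ := volume_measurePreserving_piCongrLeft _ _
  set φ := ((((MeasurableEquiv.refl _).prodCongr (g₁.trans g₂)).trans g₃).trans g₄) with hφ
  have hval : ∀ y b a i, φ (y, b, a) (e i) = Sum.elim y (Sum.elim b fun _ => a) i := by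
    intro y b a i
    rw [hφ, MeasurableEquiv.trans_apply, hg₄, MeasurableEquiv.piCongrLeft_apply_apply]
    rcases i with i | i | i <;> rfl
  refine ⟨φ, ?_, φ.measurableEmbedding, fun y b a => ⟨fun i j => ?_, fun j => ?_, fun j => ?_, ?_⟩⟩
  · exact h₄.comp (h₃.comp ((MeasurePreserving.id _).prod (h₂.comp h₁)))
  · simp only [symmetricOf, Matrix.of_apply, Fin.succ_le_succ_iff]
    split_ifs with h
    · rw [← he1 i j h, hval]; rfl
    · rw [← he1 j i (not_le.1 h).le, hval]; rfl
  · simp only [symmetricOf, Matrix.of_apply, Fin.zero_le, dite_true]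
    rw [← he2 j, hval]; rfl
  · have : ¬ Fin.succ j ≤ 0 := by simp
    simp only [symmetricOf, Matrix.of_apply, this, dite_false]
    rw [← he2 j, hval]; rfl
  · simp only [symmetricOf, Matrix.of_apply, le_refl, dite_true]
    rw [← he3 (), hval]; rfl

/-- Near 0 the exponential is at most `k! s^k / c^k` with `k = ⌈γ⌉`, which compensates `s^(-γ)`; at
infinity `γ > 1` suffices. -/
lemma lintegral_rpow_mul_exp_neg_inv_lt_top {γ c : ℝ} (hγ : 1 < γ) (hc : 0 < c) :
    ∫⁻ s in Set.Ioi (0 : ℝ), ENNReal.ofReal (s ^ (-γ) * Real.exp (-(c / s))) < ∞ := by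
  rw [← Set.Ioc_union_Ioi_eq_Ioi zero_le_one]
  refine (lintegral_union_le _ _ _).trans_lt (ENNReal.add_lt_top.2 ⟨?_, ?_⟩)
  · set k := ⌈γ⌉₊ with hk
    have h : ∀ s ∈ Set.Ioc (0 : ℝ) 1, ENNReal.ofReal (s ^ (-γ) * Real.exp (-(c / s))) ≤
        ENNReal.ofReal (k.factorial / c ^ k) := by
      rintro s ⟨hs0, hs1⟩
      refine ENNReal.ofReal_le_ofReal ?_
      have h1 : s ^ (-γ) ≤ (s ^ k)⁻¹ := by
        rw [← Real.rpow_natCast, ← Real.rpow_neg hs0.le]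
        exact Real.rpow_le_rpow_of_exponent_ge hs0 hs1 (neg_le_neg (Nat.le_ceil γ))
      have h2 : Real.exp (-(c / s)) ≤ k.factorial * s ^ k / c ^ k := by
        have h3 := Real.pow_div_factorial_le_exp (c / s) (by positivity) k
        rw [Real.exp_neg, inv_le_comm₀ (Real.exp_pos _) (by positivity)]
        refine le_trans (le_of_eq ?_) h3
        rw [div_pow]
        field_simp
      calc _ ≤ (s ^ k)⁻¹ * (k.factorial * s ^ k / c ^ k) := by gcongr
        _ = _ := by field_simp
    refine (setLIntegral_mono' measurableSet_Ioc h).trans_lt ?_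
    rw [setLIntegral_const, Real.volume_Ioc]
    exact ENNReal.mul_lt_top ENNReal.ofReal_lt_top ENNReal.ofReal_lt_top
  · have h := integrableOn_Ioi_rpow_of_lt (neg_lt_neg hγ) zero_lt_one
    refine lt_of_le_of_lt (setLIntegral_mono' measurableSet_Ioi fun s hs => ?_)
      h.lintegral_lt_top
    have hs0 : (0 : ℝ) < s := zero_lt_one.trans hs
    refine ENNReal.ofReal_le_ofReal (mul_le_of_le_one_right (by positivity) ?_)
    rw [Real.exp_le_one_iff]
    have : 0 ≤ c / s := by positivity
    linarith

lemma lintegral_exp_neg_mul_dotProduct {r : ℕ} {a : ℝ} (ha : 0 < a) :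
    ∫⁻ u : Fin r → ℝ, ENNReal.ofReal (Real.exp (-a * (u ⬝ᵥ u))) =
      ENNReal.ofReal ((Real.pi / a) ^ ((r : ℝ) / 2)) := by
  have h1 : ∀ u : Fin r → ℝ, ENNReal.ofReal (Real.exp (-a * (u ⬝ᵥ u))) =
      ∏ i, ENNReal.ofReal (Real.exp (-a * u i ^ 2)) := by
    intro u
    rw [← ENNReal.ofReal_prod_of_nonneg fun _ _ => (Real.exp_pos _).le, ← Real.exp_sum,
      dotProduct, Finset.mul_sum]
    simp only [sq]
  simp_rw [h1]
  rw [volume_pi, lintegral_fin_prod _ (f := fun _ x => ENNReal.ofReal (Real.exp (-a * x ^ 2)))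
    fun i => by fun_prop]
  rw [← ofReal_integral_eq_lintegral_ofReal (integrable_exp_neg_mul_sq ha)
    (ae_of_all _ fun x => (Real.exp_pos _).le), integral_gaussian, Finset.prod_const,
    Finset.card_univ, Fintype.card_fin, ← ENNReal.ofReal_pow (Real.sqrt_nonneg _),
    Real.sqrt_eq_rpow, ← Real.rpow_natCast, ← Real.rpow_mul (by positivity)]
  congr 2
  ring

/-- The factor contributed by the first row in the recursion for the inverse-Wishart normalizing
constant. -/
noncomputable def schurKernel {r : ℕ} (α c : ℝ) (u : Fin r → ℝ) (s : ℝ) : ℝ≥0∞ :=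
  (Set.Ioi (0 : ℝ)).indicator
    (fun s => ENNReal.ofReal (s ^ (-α) * Real.exp (-c * ((1 + u ⬝ᵥ u) / s)))) s

lemma measurable_schurKernel {r : ℕ} (α c : ℝ) :
    Measurable (Function.uncurry (schurKernel (r := r) α c)) := by
  have hdot : Measurable fun z : (Fin r → ℝ) × ℝ => z.1 ⬝ᵥ z.1 := by
    unfold dotProduct
    fun_prop
  have h1 : Measurable fun z : (Fin r → ℝ) × ℝ =>
      ENNReal.ofReal (z.2 ^ (-α) * Real.exp (-c * ((1 + z.1 ⬝ᵥ z.1) / z.2))) :=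
    ((measurable_snd.pow_const _).mul
      (((hdot.const_add 1).div measurable_snd).const_mul _).exp).ennreal_ofReal
  exact h1.indicator (measurable_snd measurableSet_Ioi)

/-- Integrating first in `u`, a Gaussian integral of variance proportional to `s`, gains `s^(r/2)`;
the remaining power `α - r/2` exceeds 1. -/
lemma lintegral_schurKernel_lt_top {r : ℕ} {α c : ℝ} (hα : (r : ℝ) / 2 + 1 < α) (hc : 0 < c) :
    ∫⁻ u : Fin r → ℝ, ∫⁻ s : ℝ, schurKernel α c u s < ∞ := by
  rw [lintegral_lintegral_swap (measurable_schurKernel α c).aemeasurable]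
  have h : ∀ s : ℝ, ∫⁻ u : Fin r → ℝ, schurKernel α c u s =
      (Set.Ioi (0 : ℝ)).indicator (fun s => ENNReal.ofReal ((Real.pi / c) ^ ((r : ℝ) / 2)) *
        ENNReal.ofReal (s ^ (-(α - r / 2)) * Real.exp (-(c / s)))) s := by
    intro s
    unfold schurKernel
    by_cases hs : s ∈ Set.Ioi (0 : ℝ)
    · have hs0 : 0 < s := hs
      simp only [Set.indicator_of_mem hs]
      have h2 : ∀ u : Fin r → ℝ,
          ENNReal.ofReal (s ^ (-α) * Real.exp (-c * ((1 + u ⬝ᵥ u) / s))) =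
          ENNReal.ofReal (s ^ (-α) * Real.exp (-(c / s))) *
            ENNReal.ofReal (Real.exp (-(c / s) * (u ⬝ᵥ u))) := by
        intro u
        rw [← ENNReal.ofReal_mul (by positivity), mul_assoc, ← Real.exp_add]
        congr 3
        ring
      simp_rw [h2]
      rw [lintegral_const_mul _ (by fun_prop), lintegral_exp_neg_mul_dotProduct (by positivity),
        ← ENNReal.ofReal_mul (by positivity), ← ENNReal.ofReal_mul (by positivity)]
      congr 1
      have h3 : (Real.pi / (c / s)) ^ ((r : ℝ) / 2) =
          (Real.pi / c) ^ ((r : ℝ) / 2) * s ^ ((r : ℝ) / 2) := by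
        rw [← Real.mul_rpow (by positivity) hs0.le]
        congr 1
        field_simp
      rw [h3, neg_sub, sub_eq_add_neg, Real.rpow_add hs0]
      ring
    · simp [Set.indicator_of_notMem hs]
  simp_rw [h]
  rw [lintegral_indicator measurableSet_Ioi, lintegral_const_mul' _ _ ENNReal.ofReal_ne_top]
  exact ENNReal.mul_lt_top ENNReal.ofReal_lt_top
    (lintegral_rpow_mul_exp_neg_inv_lt_top (by linarith) hc)

/-- The integrand of the inverse-Wishart normalizing constant, for a scalar scale matrix. -/
noncomputable def invWishartKernel {r : ℕ} (α c : ℝ) (A : Mat r) : ℝ≥0∞ :=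
  {A : Mat r | A.PosDef}.indicator
    (fun A => ENNReal.ofReal (A.det ^ (-α) * Real.exp (-c * A⁻¹.trace))) A

lemma measurable_invWishartKernel {r : ℕ} (α c : ℝ) :
    Measurable (invWishartKernel (r := r) α c) := by
  have hent : ∀ i j, Measurable fun A : Mat r => A i j := fun i j =>
    (continuous_id.matrix_elem i j).measurable
  have htr : Measurable fun A : Mat r => A⁻¹.trace := by
    unfold Matrix.trace
    exact Finset.measurable_sum _ fun i _ => measurable_inv_apply hent i i
  have : Measurable fun A : Mat r =>
      ENNReal.ofReal (A.det ^ (-α) * Real.exp (-c * A⁻¹.trace)) :=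
    (((measurable_det hent).pow_const _).mul (htr.const_mul _).exp).ennreal_ofReal
  exact this.indicator (measurableSet_posDef r)

lemma lintegral_comp_inv_mulVec {r : ℕ} {C : Mat r} (hC : C.PosDef) {k : (Fin r → ℝ) → ℝ≥0∞}
    (hk : Measurable k) :
    ∫⁻ b : Fin r → ℝ, k (C⁻¹ *ᵥ b) = ENNReal.ofReal C.det * ∫⁻ u, k u := by
  have hd := hC.det_pos
  have hdet : (C⁻¹).det ≠ 0 := hC.inv.det_pos.ne'
  have h := Real.map_matrix_volume_pi_eq_smul_volume_pi hdet
  have hdet' : (C⁻¹).det⁻¹ = C.det := by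
    rw [Matrix.det_nonsing_inv, Ring.inverse_eq_inv', inv_inv]
  rw [hdet', abs_of_pos hd] at h
  rw [← smul_eq_mul, ← lintegral_smul_measure, ← h,
    lintegral_map hk (LinearMap.continuous_of_finiteDimensional _).measurable]
  rfl

/-- The factor `det C` is the Jacobian of `b ↦ C⁻¹ b`; it lowers the exponent by one at each step of
the recursion. -/
lemma invWishartKernel_mul_det {r : ℕ} (α c : ℝ) (A : Mat r) :
    invWishartKernel α c A * ENNReal.ofReal A.det = invWishartKernel (α - 1) c A := by
  unfold invWishartKernel
  by_cases hA : A ∈ {A : Mat r | A.PosDef}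
  · have hd : 0 < A.det := Matrix.PosDef.det_pos hA
    rw [Set.indicator_of_mem hA, Set.indicator_of_mem hA, ← ENNReal.ofReal_mul (by positivity),
      neg_sub, sub_eq_add_neg, Real.rpow_add hd, Real.rpow_one]
    congr 1
    ring
  · rw [Set.indicator_of_notMem hA, Set.indicator_of_notMem hA, zero_mul]

/-- Induction on `r`. In the coordinates `C`, `u = C⁻¹ b`, `s = a - b ⬝ᵥ u`, determinant and trace
of the inverse separate the kernel into a kernel in `C` and a factor in `(u, s)`. The Jacobian
replaces `α` by `α - 1`, so the condition `r + 1 < α` becomes `r < α - 1`. -/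
lemma lintegral_invWishartKernel_lt_top {c : ℝ} (hc : 0 < c) (r : ℕ) : ∀ α : ℝ, (r : ℝ) < α →
    ∫⁻ x, invWishartKernel α c (symmetricOf (r := r) x) < ∞ := by
  induction r with
  | zero =>
    intro α _
    have hm : ∀ A : Mat 0, invWishartKernel α c A ≤ 1 := by
      intro A
      refine (Set.indicator_le_self _ _ A).trans ?_
      simp [Matrix.trace]
    calc _ ≤ ∫⁻ _x : {ij : Fin 0 × Fin 0 // ij.1 ≤ ij.2} → ℝ, 1 := lintegral_mono fun x => hm _
      _ < ∞ := by simp [volume_pi]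
  | succ r ih =>
    intro α hα
    push_cast at hα
    obtain ⟨φ, hφ, hφe, hφv⟩ := exists_measurePreserving_symmetricOf r
    have hκ : ∫⁻ u : Fin r → ℝ, ∫⁻ s, schurKernel α c u s < ∞ := by
      refine lintegral_schurKernel_lt_top ?_ hc
      have : (0 : ℝ) ≤ r := by positivity
      linarith
    have hpt : ∀ y b a, invWishartKernel α c (symmetricOf (φ (y, b, a))) ≤
        invWishartKernel α c (symmetricOf y) *
          schurKernel α c ((symmetricOf y)⁻¹ *ᵥ b) (a - b ⬝ᵥ ((symmetricOf y)⁻¹ *ᵥ b)) := by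
      intro y b a
      obtain ⟨h1, h2, h3, h4⟩ := hφv y b a
      by_cases hA : symmetricOf (φ (y, b, a)) ∈ {A : Mat (r + 1) | A.PosDef}
      · obtain ⟨hC, hs, hdet, htr⟩ := PosDef.schur hA h1 h2 h3 rfl rfl
        rw [h4] at hs hdet htr
        unfold invWishartKernel schurKernel
        rw [Set.indicator_of_mem hA, Set.indicator_of_mem (show _ ∈ {A : Mat r | A.PosDef} from hC),
          Set.indicator_of_mem (show _ ∈ Set.Ioi (0 : ℝ) from hs), hdet, htr]
        have hd := hC.det_pos
        rw [← ENNReal.ofReal_mul (by positivity), Real.mul_rpow hs.le hd.le, mul_add, Real.exp_add]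
        refine ENNReal.ofReal_le_ofReal (le_of_eq ?_)
        ring
      · rw [invWishartKernel, Set.indicator_of_notMem hA]
        exact zero_le
    have hrow : ∀ y, ∫⁻ z : (Fin r → ℝ) × ℝ, invWishartKernel α c (symmetricOf (φ (y, z))) ≤
        invWishartKernel (α - 1) c (symmetricOf y) *
          ∫⁻ u : Fin r → ℝ, ∫⁻ s, schurKernel α c u s := by
      intro y
      have hm : Measurable fun z : (Fin r → ℝ) × ℝ =>
          invWishartKernel α c (symmetricOf (φ (y, z))) :=
        (measurable_invWishartKernel α c).comp ((measurable_symmetricOf _).comp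
          (hφ.measurable.comp measurable_prodMk_left))
      have htop : invWishartKernel α c (symmetricOf y) ≠ ∞ := by
        unfold invWishartKernel
        by_cases hC : symmetricOf y ∈ {A : Mat r | A.PosDef}
        · rw [Set.indicator_of_mem hC]
          exact ENNReal.ofReal_ne_top
        · rw [Set.indicator_of_notMem hC]
          exact ENNReal.zero_ne_top
      have hk : Measurable fun u : Fin r → ℝ => ∫⁻ s, schurKernel α c u s :=
        (measurable_schurKernel α c).lintegral_prod_right'
      rw [Measure.volume_eq_prod, lintegral_prod _ hm.aemeasurable]
      calc _ ≤ ∫⁻ b : Fin r → ℝ, ∫⁻ a : ℝ, invWishartKernel α c (symmetricOf y) *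
            schurKernel α c ((symmetricOf y)⁻¹ *ᵥ b) (a - b ⬝ᵥ ((symmetricOf y)⁻¹ *ᵥ b)) :=
            lintegral_mono fun b => lintegral_mono fun a => hpt y b a
        _ = ∫⁻ b : Fin r → ℝ, invWishartKernel α c (symmetricOf y) *
            ∫⁻ s : ℝ, schurKernel α c ((symmetricOf y)⁻¹ *ᵥ b) s := by
            refine lintegral_congr fun b => ?_
            -- At fixed `b`, passing from `a` to `s` is a translation; the linear change from `b` to
            -- `u` follows.
            rw [lintegral_const_mul' _ _ htop,
              lintegral_sub_right_eq_self (schurKernel α c ((symmetricOf y)⁻¹ *ᵥ b))]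
        _ ≤ _ := by
            by_cases hC : symmetricOf y ∈ {A : Mat r | A.PosDef}
            · rw [lintegral_const_mul' _ _ htop, lintegral_comp_inv_mulVec hC hk,
                ← mul_assoc, invWishartKernel_mul_det]
            · have : invWishartKernel α c (symmetricOf y) = 0 := Set.indicator_of_notMem hC _
              simp [this]
    rw [← hφ.lintegral_comp_emb hφe, Measure.volume_eq_prod, lintegral_prod]
    · refine (lintegral_mono hrow).trans_lt ?_
      rw [lintegral_mul_const' _ _ hκ.ne]
      exact ENNReal.mul_lt_top (ih _ (by linarith)) hκ
    · exact ((measurable_invWishartKernel α c).comp ((measurable_symmetricOf _).comp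
          hφ.measurable)).aemeasurable

open scoped MatrixOrder in
lemma PosDef.exists_smul_one_le {r : ℕ} {A : Mat r} (hA : A.PosDef) :
    ∃ c : ℝ, 0 < c ∧ (A - c • (1 : Mat r)).PosSemidef := by
  rcases isEmpty_or_nonempty (Fin r) with h | h
  · exact ⟨1, one_pos, by rw [Subsingleton.elim (A - (1 : ℝ) • 1) 0]; exact .zero⟩
  · obtain ⟨i, hi⟩ := Finite.exists_min hA.isHermitian.eigenvalues
    refine ⟨_, hA.eigenvalues_pos i, ?_⟩
    have h : algebraMap ℝ (Mat r) (hA.isHermitian.eigenvalues i) ≤ A := by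
      refine (algebraMap_le_iff_le_spectrum hA.isHermitian).2 fun x hx => ?_
      rw [hA.isHermitian.spectrum_real_eq_range_eigenvalues] at hx
      obtain ⟨j, rfl⟩ := hx
      exact hi j
    rwa [Algebra.algebraMap_eq_smul_one, Matrix.le_iff] at h

-- With `B = R* R`, cyclicity turns the trace into that of `R A R*`.
open scoped MatrixOrder in
lemma trace_mul_nonneg {r : ℕ} {A B : Mat r} (hA : A.PosSemidef) (hB : B.PosSemidef) :
    0 ≤ (A * B).trace := by
  obtain ⟨R, rfl⟩ := CStarAlgebra.nonneg_iff_eq_star_mul_self.mp hB.nonneg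
  rw [← Matrix.mul_assoc, Matrix.trace_mul_comm, ← Matrix.mul_assoc, Matrix.star_eq_conjTranspose]
  exact (hA.mul_mul_conjTranspose_same R).trace_nonneg

/-- From `Sig ≥ c I` one gets `tr(Sig Γ⁻¹) ≥ c tr(Γ⁻¹)`, which reduces to a scalar scale matrix. The
exponent `(d + r + 1) / 2` exceeds `r` exactly when `d > r - 1`. -/
theorem invWishartUnnormalized_univ_ne_top {r : ℕ} {d : ℝ} (hd : (r : ℝ) - 1 < d) {Sig : Mat r}
    (hSig : Sig.PosDef) : invWishartUnnormalized d Sig Set.univ ≠ ∞ := by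
  obtain ⟨c, hc, hcS⟩ := PosDef.exists_smul_one_le hSig
  have hle : ∀ Γ ∈ {Γ : Mat r | Γ.PosDef}, ENNReal.ofReal (invWishartWeight d Sig Γ) ≤
      invWishartKernel ((d + r + 1) / 2) (c / 2) Γ := by
    intro Γ hΓ
    have hd := Matrix.PosDef.det_pos hΓ
    have h := trace_mul_nonneg hcS (Matrix.PosDef.inv hΓ).posSemidef
    rw [Matrix.sub_mul, Matrix.trace_sub, Matrix.smul_mul, Matrix.one_mul, Matrix.trace_smul,
      smul_eq_mul] at h
    rw [invWishartKernel, Set.indicator_of_mem hΓ, invWishartWeight, neg_div]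
    refine ENNReal.ofReal_le_ofReal (mul_le_mul_of_nonneg_left (Real.exp_le_exp.2 ?_)
      (by positivity))
    linarith
  rw [invWishartUnnormalized, withDensity_apply _ MeasurableSet.univ, Measure.restrict_univ]
  refine ((setLIntegral_mono' (measurableSet_posDef r) hle).trans
    (setLIntegral_le_lintegral _ _)).trans_lt ?_ |>.ne
  rw [lebesgueSymm, lintegral_map (measurable_invWishartKernel _ _) (measurable_symmetricOf r)]
  exact lintegral_invWishartKernel_lt_top (by positivity) r _ (by linarith)

end NLMM

/-- Effective dimension: the posterior concentrates on models whose size is at most a constant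
multiple of the true one, uniformly over the true parameters. -/
theorem theorem1
    -- the fixed part of the model and of the prior
    (q r : ℕ) (hq : 0 < q) (hr : 0 < r)
    (f : EuclideanSpace ℝ (Fin q) → ℝ → ℝ) (σ : ℝ) (hσ : 0 < σ)
    (d : ℝ) (hd : (r : ℝ) - 1 < d) (Sig : Matrix (Fin r) (Fin r) ℝ) (hSig : Sig.PosDef)
    -- the regression function is Lipschitz in its first argument
    (K : ℝ) (hf : ∀ x y : EuclideanSpace ℝ (Fin q), ∀ t : ℝ, |f x t - f y t| ≤ K * ‖x - y‖)
    -- the constants of the assumptions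
    (Mobs : ℕ) (b ρlo ρhi A₁ A₂ A₃ A₄ L₁ L₂ L₃ κ ζlo ζhi : ℝ)
    (hb : 0 < b) (hρlo : 0 < ρlo) (hρhi : 0 < ρhi)
    (hA₁ : 0 < A₁) (hA₂ : 0 < A₂) (hA₃ : 0 < A₃) (hA₄ : 0 < A₄)
    (hL₁ : 0 < L₁) (hL₂ : 0 < L₂) (hL₃ : 0 < L₃)
    (hκ : 0 < κ) (hζlo : 0 < ζlo) (hζhi : 0 < ζhi) :
    ∃ C₁ : ℝ, 0 < C₁ ∧
      ∀ (p : ℕ → ℕ) (D : (n : ℕ) → NLMM.Design n (p n) q r)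
        (lam : ℕ → ℝ) (π : ℕ → ℕ → ℝ) (η : ℕ → ℝ),
        -- high dimension
        (∀ᶠ n in atTop, n < p n) →
        -- at most `Mobs` observations per subject
        (∀ n i, (D n).m i ≤ Mobs) →
        -- the sparsity level in the class of true regression parameters is `o(n)`
        Tendsto η atTop (𝓝 0) →
        -- the prior on the dimension is a probability on `{0, …, qp}` with exponential decrease
        (∀ n s, 0 ≤ π n s) →
        (∀ n, ∑ s ∈ Finset.range (q * p n + 1), π n s = 1) →
        (∀ᶠ n in atTop, ∀ s, 1 ≤ s → s ≤ q * p n →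
          A₁ * (p n : ℝ) ^ (-A₃) * π n (s - 1) ≤ π n s ∧
          π n s ≤ A₂ * (p n : ℝ) ^ (-A₄) * π n (s - 1)) →
        -- the range of the Laplace parameter
        (∀ n, 0 < lam n) →
        (∀ᶠ n in atTop,
          NLMM.starNorm (D n).stackedX * √(K ^ 2 * Mobs) / (L₁ * (p n : ℝ) ^ L₂) ≤ lam n ∧
          lam n ≤ L₃ * NLMM.starNorm (D n).stackedX * √(K ^ 2 * Mobs) / √n) →
        -- a positive fraction of the subjects has at least `r` observations
        (∀ᶠ n : ℕ in atTop,
          κ * n ≤ (Finset.univ.filter fun i : Fin n => r ≤ (D n).m i).card) →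
        -- for these subjects the matrices `Z_i` have full rank, uniformly
        (∀ᶠ n in atTop, ∀ i, r ≤ (D n).m i →
          ζlo ≤ √(NLMM.rhoMin (((D n).Z i).transpose * (D n).Z i))) →
        -- the matrices `Z_i` are bounded in spectral norm
        (∀ᶠ n in atTop, ∀ i, NLMM.spNorm ((D n).Z i) ≤ ζhi) →
        Tendsto
          (fun n =>
            ⨆ β₀ ∈ NLMM.trueBeta n (p n) q (lam n) b (η n), ⨆ Γ₀ ∈ NLMM.trueGamma r ρlo ρhi,
              ∫⁻ Y, (D n).posterior f σ (NLMM.prior (p n) q (lam n) (π n) d Sig) Y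
                  {θ | C₁ * NLMM.suppCard β₀ < NLMM.suppCard θ.1}
                ∂((D n).law f σ β₀ Γ₀))
          atTop (𝓝 0) := by
  obtain ⟨w, hw, hG⟩ := NLMM.exists_invWishartUnnormalized_gammaBox_ge d Sig hρlo ρhi
  have hZ := NLMM.invWishartUnnormalized_univ_ne_top hd hSig
  set N := Fintype.card {ij : Fin r × Fin r // ij.1 ≤ ij.2} with hN
  -- Chosen so that `(A₄ / 2) (C₁ - 1)` equals `b + L₂ + 3`, the cost per coordinate near the truth,
  -- plus three spare powers and the `N` covariance entries.
  refine ⟨1 + 2 * (b + L₂ + 3 + 3 + N) / A₄, by positivity, ?_⟩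
  intro p D lam π η hp hM _ hπ hπ1 hdecay hlam hlam' _ _ _
  obtain ⟨V, hV⟩ : ∃ V : ℝ, V = Real.exp ((Mobs : ℝ) / 2) * Real.exp (1 / σ ^ 2) +
      2 * q / (w * (ρlo / r) ^ N) * (NLMM.invWishartUnnormalized d Sig Set.univ).toReal := ⟨_, rfl⟩
  have hV0 : 0 ≤ V := by rw [hV]; positivity
  have hp_top : Tendsto (fun n => (p n : ℝ)) atTop atTop :=
    tendsto_atTop_mono' _ (hp.mono fun n hn => Nat.cast_le.2 hn.le)
      tendsto_natCast_atTop_atTop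
  have hlim : Tendsto (fun n => ENNReal.ofReal (V * (p n : ℝ)⁻¹)) atTop (𝓝 0) := by
    have := ENNReal.tendsto_ofReal ((tendsto_inv_atTop_zero.comp hp_top).const_mul V)
    simpa using this
  refine tendsto_of_tendsto_of_tendsto_of_le_of_le' tendsto_const_nhds hlim
    (Eventually.of_forall fun _ => zero_le) ?_
  -- Half of the exponent `A₄` is spent on absorbing the constant `A₂`, leaving the clean decay
  -- `p^(-A₄ / 2)`.
  have hpA : ∀ᶠ n in atTop, A₂ ≤ (p n : ℝ) ^ (A₄ / 2) :=
    ((tendsto_rpow_atTop (by positivity)).comp hp_top).eventually_ge_atTop A₂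
  filter_upwards [hp, hdecay, hlam', hpA, hp_top.eventually_ge_atTop (L₁ * q ^ 2 * Real.exp L₃),
    eventually_ge_atTop 1] with n hnp hdec hlamn hpAn hpL hn
  have hP0 : (0 : ℝ) < p n := by exact_mod_cast (hn.trans hnp.le)
  refine iSup₂_le fun β₀ hβ₀ => iSup₂_le fun Γ₀ hΓ₀ => ?_
  rw [hV]
  refine NLMM.lintegral_posterior_suppCard_le hn hnp hq hr (D n) hf hσ (hM n) hZ hρlo hw hG
    (hlam n) hL₁ hL₃ (α := A₄ / 2) (by positivity)
    (c₁ := A₁ * (p n : ℝ) ^ (-A₃)) (by positivity) (hπ n) (hπ1 n) ?_ hlamn.1 hlamn.2 hpL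
    ?_ ?_ hβ₀.1 hβ₀.2.1 hΓ₀
  · intro s h1 h2
    refine ⟨(hdec s h1 h2).1, (hdec s h1 h2).2.trans ?_⟩
    have hs := hπ n (s - 1)
    gcongr
    calc A₂ * (p n : ℝ) ^ (-A₄) ≤ (p n : ℝ) ^ (A₄ / 2) * (p n : ℝ) ^ (-A₄) := by gcongr
      _ = (p n : ℝ) ^ (-(A₄ / 2)) := by
          rw [← Real.rpow_add hP0]
          congr 1
          ring
  · have : 0 ≤ 2 * (b + L₂ + 3 + 3 + N) / A₄ := by positivity
    linarith
  · refine le_of_eq ?_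
    field_simp
    ring
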